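/- Let $\Omega,\tilde\Omega\subset\mathbb{R}^n$ be uniformly convex domains with smooth boundary, i.e. compact convex sets with non-empty interior and smooth boundary, all of whose principal curvatures are bounded below by a positive constant. For a symmetric $n\times n$ matrix $M$ with eigenvalues $\lambda_1,\dots,\lambda_n$ (with multiplicity) put $F(M)=\sum_{k=1}^n\arctan\lambda_k$. Consider the problem $(\star)$ Find a convex function $u:\Omega\to\mathbb{R}$ and a constant $c\in(0,\frac{n\pi}{2})$ such that $\nabla u$ is a diffeomorphism from $\Omega$ to $\tilde\Omega$ (smooth, with smooth inverse, up to the boundary) and $F(D^2u(x))=c$ for all $x\in\Omega$. Then there exists a constant $C_{11}>0$, depending only on $\Omega$ and $\tilde\Omega$, such that every solution $(u,c)$ of $(\star)$ satisfies \[\sum_{k,l=1}^n \partial_k\partial_l u(x)\,w_k\,w_l\;\ge\;\frac{1}{C_{11}}\,|w|^2\qquad\text{for all }x\in\Omega\text{ and all }w\in\mathbb{R}^n .\] -/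

import Mathlib

open scoped ContDiff

/-- A uniformly convex domain with smooth boundary in `ℝⁿ`, taken together with its boundary:
a compact convex set `Ω` with non-empty interior which, near each of its boundary points `x`, is
a sublevel set `{ρ ≤ 0}` of a smooth function `ρ` with `Dρ(x) ≠ 0`, and all of whose principal
curvatures are at least some constant `κ > 0`. Here the second fundamental form of the boundary
at `x` (with respect to the inner normal) is `w ↦ D²ρ(x)(w, w) / |Dρ(x)|` on the tangent space
`{w : Dρ(x) w = 0}`. -/
structure IsUniformlyConvexDomain {n : ℕ} (Ω : Set (EuclideanSpace ℝ (Fin n))) : Prop where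
  isCompact : IsCompact Ω
  convex : Convex ℝ Ω
  nonempty_interior : (interior Ω).Nonempty
  smooth_boundary : ∃ κ : ℝ, 0 < κ ∧ ∀ x ∈ frontier Ω,
    ∃ ρ : EuclideanSpace ℝ (Fin n) → ℝ, ContDiff ℝ ∞ ρ ∧ fderiv ℝ ρ x ≠ 0 ∧
      (∀ᶠ y in nhds x, y ∈ Ω ↔ ρ y ≤ 0) ∧
      ∀ w : EuclideanSpace ℝ (Fin n), fderiv ℝ ρ x w = 0 →
        κ * ‖fderiv ℝ ρ x‖ * ‖w‖ ^ 2 ≤ fderiv ℝ (fderiv ℝ ρ) x w w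

/-- `f` is a diffeomorphism from `s` onto `t`: smooth on `s` (up to the boundary, if `s` is a
closed domain), with a two-sided inverse `t → s` that is smooth on `t`. -/
def IsDiffeomorphismOn {n : ℕ} (f : EuclideanSpace ℝ (Fin n) → EuclideanSpace ℝ (Fin n))
    (s t : Set (EuclideanSpace ℝ (Fin n))) : Prop :=
  ContDiffOn ℝ ∞ f s ∧ Set.MapsTo f s t ∧
    ∃ g : EuclideanSpace ℝ (Fin n) → EuclideanSpace ℝ (Fin n),
      ContDiffOn ℝ ∞ g t ∧ Set.MapsTo g t s ∧ Set.InvOn g f s t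

/-- The Hessian matrix `(∂ᵢ ∂ⱼ u(x))` of a function `u` on `Ω`; the derivatives are taken within
`Ω`, so that they are the one-sided ones at the boundary points of a closed domain. -/
noncomputable def hessianMatrix {n : ℕ} (Ω : Set (EuclideanSpace ℝ (Fin n)))
    (u : EuclideanSpace ℝ (Fin n) → ℝ) (x : EuclideanSpace ℝ (Fin n)) :
    Matrix (Fin n) (Fin n) ℝ :=
  Matrix.of fun i j =>
    fderivWithin ℝ (fderivWithin ℝ u Ω) Ω x
      (EuclideanSpace.single i 1) (EuclideanSpace.single j 1)

/-- `F(M) = ∑ₖ arctan λₖ`, the sum over the eigenvalues of the symmetric matrix `M`, repeated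
according to their multiplicity. -/
noncomputable def lagrangianAngle {n : ℕ} (M : Matrix (Fin n) (Fin n) ℝ) : ℝ :=
  (M.charpoly.roots.map Real.arctan).sum

theorem lagrangianAngle_eq_sum_eigenvalues {n : ℕ} {M : Matrix (Fin n) (Fin n) ℝ}
    (hM : M.IsHermitian) :
    lagrangianAngle M = ∑ k, Real.arctan (hM.eigenvalues k) := by
  rw [lagrangianAngle, hM.roots_charpoly_eq_eigenvalues]
  rw [Multiset.map_map]
  rfl

/-- The Hessian matrix of a smooth function on a uniformly convex domain is symmetric. -/
theorem hessianMatrix_isHermitian {n : ℕ} {Ω : Set (EuclideanSpace ℝ (Fin n))}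
    (hΩ : IsUniformlyConvexDomain Ω) {u : EuclideanSpace ℝ (Fin n) → ℝ}
    (hu : ContDiffOn ℝ ∞ u Ω) {x : EuclideanSpace ℝ (Fin n)} (hx : x ∈ Ω) :
    (hessianMatrix Ω u x).IsHermitian := by
  have hcl : x ∈ closure (interior Ω) := by
    rw [hΩ.convex.closure_interior_eq_closure_of_nonempty_interior hΩ.nonempty_interior]
    exact subset_closure hx
  have h := (hu x hx).isSymmSndFDerivWithinAt (by simpa using WithTop.coe_le_coe.2 (le_top : (2 : ℕ∞) ≤ ⊤))
    (uniqueDiffOn_convex hΩ.convex hΩ.nonempty_interior) hcl hx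
  ext i j
  simpa [hessianMatrix] using h (EuclideanSpace.single j 1) (EuclideanSpace.single i 1)

/-- The pair `(u, c)` solves the second boundary value problem for the special Lagrangian
equation: `u` is a (smooth) convex function on `Ω`, its gradient is a diffeomorphism from `Ω`
onto `Ω'`, the constant `c` lies in `(0, nπ/2)`, and `F(D²u) = c` on `Ω`. -/
structure IsMinimalLagrangianPotential {n : ℕ} (Ω Ω' : Set (EuclideanSpace ℝ (Fin n)))
    (u : EuclideanSpace ℝ (Fin n) → ℝ) (c : ℝ) : Prop where
  contDiffOn : ContDiffOn ℝ ∞ u Ω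
  convexOn : ConvexOn ℝ Ω u
  isDiffeomorphismOn : IsDiffeomorphismOn (gradientWithin u Ω) Ω Ω'
  mem_Ioo : c ∈ Set.Ioo 0 (n * Real.pi / 2)
  angle_eq : ∀ x ∈ Ω, lagrangianAngle (hessianMatrix Ω u x) = c

/-! ### Second derivative tests, compactness bounds and Taylor inequalities. -/

section Calculus

open Filter Topology Metric Set

/-! Inverting the gradient turns the lower bound into an upper bound. If `g : Ω' → Ω` inverts `∇u`,
then `Dg` is symmetric and positive with eigenvalues `1/λₖ`, and `arctan (1/λ) = π/2 - arctan λ`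
keeps the angle constant. So it suffices to bound `Df` from above, uniformly over all maps `f`
between two fixed domains with `Df` symmetric, positive and of constant angle (`IsLagrangianMap`,
`exists_upper_bound`).

At a point where `Df` has eigenvectors `eₖ` and eigenvalues `lₖ`, the linearized operator is `L = ∑
(1 + lₖ²)⁻¹ ∂²` along the `eₖ`. Then `L f = 0`, and `L ⟨Df w, w⟩ ≥ 0` because `arctan` is concave on
`[0, ∞)`. For smooth `Φ` one has `L (Φ(y, f y)) ≥ -nK`, since the weight cancels the growth `lₖ²`.
The trace of `L` is bounded below (`exists_pos_le_sum`), because a bounded image keeps the angle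
away from `nπ/2`. Hence a quadratic barrier touching the boundary at `x₀` absorbs all errors
(`comparison`), and the normal derivative of `s ⟨Df w, w⟩ + Φ` at a boundary maximum is controlled
from one side (`exists_boundary_estimate`).

The bounds on the boundary come from choices of `Φ`. Let `h`, `h'` be defining functions, `ν =
∇h(x)` and `ν' = ∇h'(f x)`; as `f` sends boundary to boundary, `Df ν' = τ ν` with `τ > 0`. The
choice `-h' ∘ f` bounds `τ`. The choice `-⟨ν, ν'⟩`, differentiated along `ν'` at its maximum, bounds
`⟨ν, ν'⟩` away from `0`. If `M > 1` is the largest tangential value of `⟨Df w, w⟩`, a correction of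
`M⁻¹ ⟨Df w, w⟩` yields `∂_ν' ⟨Df w, w⟩ ≥ -C M`, whereas uniform convexity of the target, tested
along a parabola, yields `2κM² ≤ C - ∂_ν' ⟨Df w, w⟩`; so `M` is bounded. Splitting `w` into a
tangential part and a multiple of `ν'` bounds `Df` on the boundary, and comparison carries the bound
inside. -/

/-- A twice differentiable function of one variable with a critical point at `0` and negative
second derivative there has a local maximum at `0`. -/
theorem isLocalMax_of_hasDerivAt_neg {φ φ' : ℝ → ℝ} {a : ℝ}
    (h1 : ∀ᶠ t in 𝓝 0, HasDerivAt φ (φ' t) t) (h0 : φ' 0 = 0) (h2 : HasDerivAt φ' a 0)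
    (ha : a < 0) : IsLocalMax φ 0 := by
  have hd : deriv φ =ᶠ[𝓝 0] φ' := h1.mono fun t ht => ht.deriv
  refine isLocalMax_of_deriv_deriv_neg ?_ ?_ h1.self_of_nhds.continuousAt
  · rw [hd.deriv_eq, h2.deriv]; exact ha
  · rw [hd.self_of_nhds, h0]

/-- Second derivative test: the second derivative is nonpositive at a local maximum. -/
theorem IsLocalMax.second_deriv_nonpos {φ φ' : ℝ → ℝ} {a : ℝ} (hmax : IsLocalMax φ 0)
    (h1 : ∀ᶠ t in 𝓝 0, HasDerivAt φ (φ' t) t) (h2 : HasDerivAt φ' a 0) : a ≤ 0 := by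
  by_contra! ha
  have h0 : φ' 0 = 0 := hmax.hasDerivAt_eq_zero h1.self_of_nhds
  -- If `a > 0`, then `-φ` has a local maximum at `0` as well, so `φ` is locally constant and `a =
  -- 0`.
  have hmin : IsLocalMax (-φ) 0 :=
    isLocalMax_of_hasDerivAt_neg (φ' := -φ') (h1.mono fun t ht => ht.neg) (by simp [h0]) h2.neg
      (by linarith)
  have hc : φ =ᶠ[𝓝 0] fun _ => φ 0 := by
    filter_upwards [hmax, hmin] with t ht ht'
    simp only [Pi.neg_apply, neg_le_neg_iff] at ht'
    exact le_antisymm ht ht'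
  have hz : φ' =ᶠ[𝓝 0] fun _ => 0 := by
    filter_upwards [h1, hc.eventuallyEq_nhds] with t ht ht'
    rw [← ht.deriv, ht'.deriv_eq, deriv_const]
  have := h2.deriv
  rw [hz.deriv_eq, deriv_const] at this
  exact ha.ne this

/-- A continuous positive function on a compact set is bounded below by a positive constant. -/
theorem IsCompact.exists_pos_forall_le {X : Type*} [TopologicalSpace X] {K : Set X}
    (hK : IsCompact K) {f : X → ℝ} (hf : ContinuousOn f K) (hpos : ∀ x ∈ K, 0 < f x) :
    ∃ θ : ℝ, 0 < θ ∧ ∀ x ∈ K, θ ≤ f x := by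
  rcases K.eq_empty_or_nonempty with rfl | hne
  · exact ⟨1, one_pos, by simp⟩
  · obtain ⟨x, hx, hmin⟩ := hK.exists_isMinOn hne hf
    exact ⟨f x, hpos x hx, fun y hy => hmin hy⟩

/-- A continuous function on a compact set is bounded above by a positive constant. -/
theorem IsCompact.exists_pos_forall_ge {X : Type*} [TopologicalSpace X] {K : Set X}
    (hK : IsCompact K) {f : X → ℝ} (hf : ContinuousOn f K) :
    ∃ C : ℝ, 0 < C ∧ ∀ x ∈ K, f x ≤ C := by
  rcases K.eq_empty_or_nonempty with rfl | hne
  · exact ⟨1, one_pos, by simp⟩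
  · obtain ⟨x, hx, hmax⟩ := hK.exists_isMaxOn hne hf
    exact ⟨|f x| + 1, by positivity, fun y hy => (hmax hy).trans (by linarith [le_abs_self (f x)])⟩

/-- If `f` is positive on the zero set of `g ≥ 0` in a compact set, then `f + A g` is bounded
below by a positive constant for large `A`. -/
theorem IsCompact.exists_pos_le_add_mul {X : Type*} [TopologicalSpace X] {K : Set X}
    (hK : IsCompact K) {f g : X → ℝ} (hf : ContinuousOn f K) (hg : ContinuousOn g K)
    (hg0 : ∀ x ∈ K, 0 ≤ g x) (hpos : ∀ x ∈ K, g x = 0 → 0 < f x) :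
    ∃ A : ℝ, 0 ≤ A ∧ ∃ θ : ℝ, 0 < θ ∧ ∀ x ∈ K, θ ≤ f x + A * g x := by
  have hZ : IsCompact (K ∩ f ⁻¹' Iic 0) := by
    obtain ⟨u, hu, hu'⟩ := (continuousOn_iff_isClosed.1 hf) (Iic 0) isClosed_Iic
    rw [Set.inter_comm, hu', Set.inter_comm]
    exact hK.inter_right hu
  obtain ⟨γ, hγ, hγ'⟩ := hZ.exists_pos_forall_le (hg.mono inter_subset_left) fun x hx =>
    lt_of_le_of_ne (hg0 x hx.1) fun h => absurd (hpos x hx.1 h.symm) (not_lt.2 hx.2)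
  obtain ⟨m, hm, hm'⟩ := hK.exists_pos_forall_ge hf.neg
  -- Where `f ≤ 0` one has `g ≥ γ` and `f ≥ -m`, so this coefficient makes the sum at least `1`
  -- there.
  refine ⟨(m + 1) / γ, by positivity, ?_⟩
  refine hK.exists_pos_forall_le (hf.add (continuousOn_const.mul hg)) fun x hx => ?_
  by_cases h : f x ≤ 0
  · have h1 := hγ' x ⟨hx, h⟩
    have h2 : m + 1 ≤ (m + 1) / γ * g x := by
      rw [div_mul_eq_mul_div, le_div_iff₀ hγ]
      exact mul_le_mul_of_nonneg_left h1 (by positivity)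
    have h3 := hm' x hx
    simp only [Pi.neg_apply] at h3
    linarith
  · have h2 : 0 ≤ (m + 1) / γ * g x := mul_nonneg (by positivity) (hg0 x hx)
    push Not at h
    linarith

variable {E : Type*} [NormedAddCommGroup E] [NormedSpace ℝ E]

/-- Compactness of `S` times the unit sphere, then homogeneity. This upgrades convexity in
tangential directions to a positive definite Hessian by adding a multiple of the squared normal
form. -/
theorem IsCompact.exists_pos_mul_sq_le_of_forall_ker [FiniteDimensional ℝ E] {S : Set E}
    (hS : IsCompact S) {Q : E → E →L[ℝ] E →L[ℝ] ℝ} {l : E → E →L[ℝ] ℝ} (hQ : ContinuousOn Q S)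
    (hl : ContinuousOn l S) (h : ∀ x ∈ S, ∀ v, v ≠ 0 → l x v = 0 → 0 < Q x v v) :
    ∃ A : ℝ, 0 ≤ A ∧ ∃ θ : ℝ, 0 < θ ∧
      ∀ x ∈ S, ∀ v, θ * ‖v‖ ^ 2 ≤ Q x v v + A * (l x v) ^ 2 := by
  have hQ' : ContinuousOn (fun z : E × E => Q z.1) (S ×ˢ sphere (0 : E) 1) :=
    hQ.comp continuousOn_fst fun z hz => hz.1
  have hl' : ContinuousOn (fun z : E × E => l z.1) (S ×ˢ sphere (0 : E) 1) :=
    hl.comp continuousOn_fst fun z hz => hz.1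
  obtain ⟨A, hA, θ, hθ, H⟩ := (hS.prod (isCompact_sphere (0 : E) 1)).exists_pos_le_add_mul
    (f := fun z : E × E => Q z.1 z.2 z.2) (g := fun z : E × E => (l z.1 z.2) ^ 2)
    ((hQ'.clm_apply continuousOn_snd).clm_apply continuousOn_snd)
    ((hl'.clm_apply continuousOn_snd).pow 2) (fun _ _ => sq_nonneg _) (fun z hz hz0 =>
      h z.1 hz.1 z.2 (fun h0 => by
        have := hz.2
        simp [h0] at this) (by simpa using hz0))
  refine ⟨A, hA, θ, hθ, fun x hx v => ?_⟩
  rcases eq_or_ne v 0 with rfl | hv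
  · simp
  have hv' : 0 < ‖v‖ := norm_pos_iff.2 hv
  have := H (x, ‖v‖⁻¹ • v) ⟨hx, by simp [norm_smul, hv'.ne']⟩
  simp only [map_smul, smul_apply, smul_eq_mul] at this
  have e : Q x v v + A * (l x v) ^ 2 = ‖v‖ ^ 2 *
      (‖v‖⁻¹ * (‖v‖⁻¹ * Q x v v) + A * (‖v‖⁻¹ * l x v) ^ 2) := by
    field_simp
  rw [e, mul_comm]
  exact mul_le_mul_of_nonneg_left this (by positivity)

theorem ContDiff.hasFDerivAt_fderiv {F : Type*} [NormedAddCommGroup F] [NormedSpace ℝ F]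
    {h : E → F} (hh : ContDiff ℝ ∞ h) (x : E) :
    HasFDerivAt (fderiv ℝ h) (fderiv ℝ (fderiv ℝ h) x) x :=
  ((hh.fderiv_right (m := ∞) (by simp)).differentiable (by simp) x).hasFDerivAt

theorem ContDiff.hasFDerivAt_of_infty {F : Type*} [NormedAddCommGroup F] [NormedSpace ℝ F]
    {h : E → F} (hh : ContDiff ℝ ∞ h) (x : E) : HasFDerivAt h (fderiv ℝ h x) x :=
  (hh.differentiable (by simp) x).hasFDerivAt

theorem ContDiff.continuous_fderiv_fderiv {h : E → ℝ} (hh : ContDiff ℝ ∞ h) :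
    Continuous (fderiv ℝ (fderiv ℝ h)) :=
  (hh.fderiv_right (m := ∞) (by simp)).continuous_fderiv (by simp)

/-- A smooth function `h` with `h(x) = 0` and `Dh(x) w = 0` is nonpositive along the parabola
`t ↦ x + t w - t² p` if `D²h(x)(w, w) < 2 Dh(x) p`. -/
theorem ContDiff.eventually_parabola_nonpos {h : E → ℝ} (hh : ContDiff ℝ ∞ h) {x w p : E}
    (hx : h x = 0) (hw : fderiv ℝ h x w = 0)
    (hp : fderiv ℝ (fderiv ℝ h) x w w < 2 * fderiv ℝ h x p) :
    ∀ᶠ t : ℝ in 𝓝 0, h (x + t • w - t ^ 2 • p) ≤ 0 := by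
  have hγ : ∀ t : ℝ, HasDerivAt (fun t : ℝ => x + t • w - t ^ 2 • p) (w - (2 * t) • p) t := by
    intro t
    have := (((hasDerivAt_id t).smul_const w).const_add x).fun_sub
      ((hasDerivAt_pow 2 t).smul_const p)
    simpa using this
  have hγ' : HasDerivAt (fun t : ℝ => w - (2 * t) • p) (-((2 : ℝ) • p)) 0 := by
    have := (((hasDerivAt_id (0 : ℝ)).const_mul 2).smul_const p).const_sub w
    simpa using this
  have h1 : ∀ t : ℝ, HasDerivAt (fun t : ℝ => h (x + t • w - t ^ 2 • p))
      (fderiv ℝ h (x + t • w - t ^ 2 • p) (w - (2 * t) • p)) t := fun t =>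
    (hh.hasFDerivAt_of_infty _).comp_hasDerivAt t (hγ t)
  have h2 : HasDerivAt (fun t : ℝ => fderiv ℝ h (x + t • w - t ^ 2 • p) (w - (2 * t) • p))
      (fderiv ℝ (fderiv ℝ h) x w w - 2 * fderiv ℝ h x p) 0 := by
    have := ((hh.hasFDerivAt_fderiv _).comp_hasDerivAt (0 : ℝ) (hγ 0)).clm_apply hγ'
    simpa [sub_eq_add_neg] using this
  have hmax := isLocalMax_of_hasDerivAt_neg (Eventually.of_forall h1) (by simpa using hw) h2
    (by linarith)
  refine hmax.mono fun t ht => ?_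
  simpa [hx] using ht

theorem fderiv_add_const_mul_sq {h : E → ℝ} (hh : ContDiff ℝ ∞ h) (A : ℝ) (x : E) :
    fderiv ℝ (fun y => h y + A * h y ^ 2) x = (1 + 2 * A * h x) • fderiv ℝ h x := by
  have h1 := hh.hasFDerivAt_of_infty x
  have := (h1.add ((h1.pow 2).const_mul A)).fderiv
  refine this.trans ?_
  ext v
  simp
  ring

/-- On `{h = 0}` the square adds exactly `2A Dh ⊗ Dh` to the Hessian and leaves `Dh` unchanged. -/
theorem fderiv_fderiv_add_const_mul_sq {h : E → ℝ} (hh : ContDiff ℝ ∞ h) (A : ℝ) (x v w : E) :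
    fderiv ℝ (fderiv ℝ (fun y => h y + A * h y ^ 2)) x v w =
      (1 + 2 * A * h x) * fderiv ℝ (fderiv ℝ h) x v w +
        2 * A * fderiv ℝ h x v * fderiv ℝ h x w := by
  have e : fderiv ℝ (fun y => h y + A * h y ^ 2) = fun y => (1 + 2 * A * h y) • fderiv ℝ h y :=
    funext fun y => fderiv_add_const_mul_sq hh A y
  rw [e]
  have h1 := hh.hasFDerivAt_of_infty x
  have := (((h1.const_mul (2 * A)).const_add 1).fun_smul (hh.hasFDerivAt_fderiv x)).fderiv
  rw [this]
  simp

/-- Taylor's inequality for a function with second derivative at least `m` on `[0, 1]`. -/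
theorem add_deriv_add_half_le {φ φ' φ'' : ℝ → ℝ} {m : ℝ} (h1 : ∀ t, HasDerivAt φ (φ' t) t)
    (h2 : ∀ t, HasDerivAt φ' (φ'' t) t) (hm : ∀ t ∈ Ioo (0 : ℝ) 1, m ≤ φ'' t) :
    φ 0 + φ' 0 + m / 2 ≤ φ 1 := by
  have h1' : ∀ t, HasDerivAt (fun t => φ t - m / 2 * t ^ 2) (φ' t - m * t) t := by
    intro t
    refine ((h1 t).fun_sub ((hasDerivAt_pow 2 t).const_mul (m / 2))).congr_deriv ?_
    norm_num
    ring
  have h2' : ∀ t, HasDerivAt (fun t => φ' t - m * t) (φ'' t - m) t := by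
    intro t
    have := (h2 t).fun_sub ((hasDerivAt_id t).const_mul m)
    simpa using this
  have hc : ConvexOn ℝ (Icc (0 : ℝ) 1) (fun t => φ t - m / 2 * t ^ 2) := by
    refine convexOn_of_hasDerivWithinAt2_nonneg (convex_Icc 0 1)
      (fun t _ => (h1' t).continuousAt.continuousWithinAt) (fun t _ => (h1' t).hasDerivWithinAt)
      (fun t _ => (h2' t).hasDerivWithinAt) fun t ht => ?_
    rw [interior_Icc] at ht
    linarith [hm t ht]
  have := hc.le_slope_of_hasDerivAt (by simp) (by simp) one_pos (h1' 0)
  simp [slope_def_field] at this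
  linarith

/-- A smooth function with `D²h ≥ m` on a segment lies above its tangent paraboloid. -/
theorem ContDiff.add_fderiv_add_le {h : E → ℝ} (hh : ContDiff ℝ ∞ h) {x y : E} {m : ℝ}
    (hm : ∀ t ∈ Ioo (0 : ℝ) 1, m * ‖y - x‖ ^ 2 ≤
      fderiv ℝ (fderiv ℝ h) (x + t • (y - x)) (y - x) (y - x)) :
    h x + fderiv ℝ h x (y - x) + m / 2 * ‖y - x‖ ^ 2 ≤ h y := by
  have hγ : ∀ t : ℝ, HasDerivAt (fun t : ℝ => x + t • (y - x)) (y - x) t := by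
    intro t
    simpa using ((hasDerivAt_id t).smul_const (y - x)).const_add x
  have h1 : ∀ t : ℝ, HasDerivAt (fun t : ℝ => h (x + t • (y - x)))
      (fderiv ℝ h (x + t • (y - x)) (y - x)) t := fun t =>
    (hh.hasFDerivAt_of_infty _).comp_hasDerivAt t (hγ t)
  have h2 : ∀ t : ℝ, HasDerivAt (fun t : ℝ => fderiv ℝ h (x + t • (y - x)) (y - x))
      (fderiv ℝ (fderiv ℝ h) (x + t • (y - x)) (y - x) (y - x)) t := fun t => by
    have := ((hh.hasFDerivAt_fderiv _).comp_hasDerivAt t (hγ t)).clm_apply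
      (hasDerivAt_const t (y - x))
    simpa using this
  have := add_deriv_add_half_le h1 h2 hm
  simp only [zero_smul, add_zero, one_smul, add_sub_cancel] at this
  linarith

end Calculus

/-! ### Global defining functions with quadratic support and positive Hessian. -/

section ConvexDomain

open Filter Topology Metric Set

theorem eq_zero_of_mem_frontier_of_eventually_iff {E : Type*} [NormedAddCommGroup E]
    {Ω : Set E} (hΩ : IsClosed Ω) {x : E}
    (hx : x ∈ frontier Ω) {r : E → ℝ} (hr : Continuous r)
    (h : ∀ᶠ y in 𝓝 x, y ∈ Ω ↔ r y ≤ 0) : r x = 0 := by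
  have hxΩ : x ∈ Ω := hΩ.frontier_subset hx
  refine le_antisymm (h.self_of_nhds.1 hxΩ) ?_
  by_contra! hlt
  have : ∀ᶠ y in 𝓝 x, y ∈ Ω := by
    filter_upwards [h, hr.continuousAt.eventually_lt_const hlt] with y hy hy'
    exact hy.2 hy'.le
  exact hx.2 (mem_interior_iff_mem_nhds.2 this)

/-- Near `x₀` the function `r` is strongly convex, so Taylor's inequality gives quadratic support
for nearby points of `Ω`; convexity of `Ω` extends this to all of `Ω`. -/
theorem exists_ball_support {E : Type*} [NormedAddCommGroup E] [InnerProductSpace ℝ E]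
    {Ω : Set E} (hcpt : IsCompact Ω) (hconv : Convex ℝ Ω) {x₀ : E}
    {r : E → ℝ} (hr : ContDiff ℝ ∞ r) {θ : ℝ} (hθ : 0 < θ)
    (hpos : ∀ v, θ * ‖v‖ ^ 2 ≤ fderiv ℝ (fderiv ℝ r) x₀ v v)
    (hsub : ∀ᶠ y in 𝓝 x₀, y ∈ Ω ↔ r y ≤ 0) :
    ∃ δ : ℝ, 0 < δ ∧ ∃ κ : ℝ, 0 < κ ∧ (∀ y ∈ ball x₀ δ, y ∈ Ω ↔ r y ≤ 0) ∧
      ∀ x ∈ frontier Ω, x ∈ ball x₀ δ →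
        r x = 0 ∧ ∀ y ∈ Ω, fderiv ℝ r x (y - x) ≤ -κ * ‖y - x‖ ^ 2 := by
  have hcont := hr.continuous_fderiv_fderiv
  have hnear : ∀ᶠ y in 𝓝 x₀, ∀ v, θ / 2 * ‖v‖ ^ 2 ≤ fderiv ℝ (fderiv ℝ r) y v v := by
    have : ∀ᶠ y in 𝓝 x₀, ‖fderiv ℝ (fderiv ℝ r) y - fderiv ℝ (fderiv ℝ r) x₀‖ < θ / 2 := by
      have hc : Continuous fun y => ‖fderiv ℝ (fderiv ℝ r) y - fderiv ℝ (fderiv ℝ r) x₀‖ :=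
        Continuous.norm (E := E →L[ℝ] E →L[ℝ] ℝ) (hcont.sub continuous_const)
      refine hc.continuousAt.eventually_lt_const ?_
      simp only [sub_self]
      exact (norm_zero (E := E →L[ℝ] E →L[ℝ] ℝ)).trans_lt (half_pos hθ)
    filter_upwards [this] with y hy v
    have h1 : |(fderiv ℝ (fderiv ℝ r) y - fderiv ℝ (fderiv ℝ r) x₀) v v| ≤
        θ / 2 * ‖v‖ * ‖v‖ := by
      refine (ContinuousLinearMap.le_opNorm₂
        (fderiv ℝ (fderiv ℝ r) y - fderiv ℝ (fderiv ℝ r) x₀) v v).trans ?_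
      gcongr
    have h2 := (abs_le.1 h1).1
    simp only [sub_apply] at h2
    have := hpos v
    nlinarith
  obtain ⟨δ', hδ', hδ⟩ := Metric.eventually_nhds_iff_ball.1 (hnear.and hsub)
  obtain ⟨D, hD⟩ := Metric.isBounded_iff.1 hcpt.isBounded
  set D' := max D 0
  have hD' : 0 ≤ D' := le_max_right _ _
  set δ := δ' / 2
  have hδ0 : 0 < δ := by positivity
  -- A point `y` of `Ω` may lie far from `x`; contracting `y - x` by `s` gives length at most `δ`
  -- and keeps the segment in the ball of radius `δ' = 2δ`.
  set s := δ / (D' + δ)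
  have hs0 : 0 < s := by positivity
  have hs1 : s ≤ 1 := by
    rw [div_le_one (by positivity)]
    linarith
  refine ⟨δ, hδ0, θ / 4 * s, by positivity,
    fun y hy => (hδ y (ball_subset_ball (by simp only [δ]; linarith) hy)).2, fun x hx hxb => ?_⟩
  have hx0 : r x = 0 := by
    refine eq_zero_of_mem_frontier_of_eventually_iff hcpt.isClosed hx hr.continuous ?_
    filter_upwards [isOpen_ball.mem_nhds hxb] with y hy
    exact (hδ y (ball_subset_ball (by simp only [δ]; linarith) hy)).2
  refine ⟨hx0, fun y hy => ?_⟩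
  have hxΩ := hcpt.isClosed.frontier_subset hx
  have hin : ∀ t ∈ Icc (0 : ℝ) 1, x + t • (s • (y - x)) ∈ ball x₀ δ' := by
    intro t ht
    have h1 : ‖y - x‖ ≤ D' := by
      rw [← dist_eq_norm]
      exact (hD hy hxΩ).trans (le_max_left _ _)
    have h2 : ‖t • (s • (y - x))‖ ≤ δ := by
      rw [norm_smul, norm_smul, Real.norm_of_nonneg ht.1, Real.norm_of_nonneg hs0.le]
      calc t * (s * ‖y - x‖) ≤ 1 * (s * D') := by
            gcongr
            exact ht.2
        _ ≤ δ := by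
            rw [one_mul]
            simp only [s]
            rw [div_mul_eq_mul_div, div_le_iff₀ (by positivity)]
            nlinarith
    rw [mem_ball, dist_eq_norm] at hxb ⊢
    calc ‖x + t • (s • (y - x)) - x₀‖ = ‖(x - x₀) + t • (s • (y - x))‖ := by
          congr 1; abel
      _ ≤ ‖x - x₀‖ + ‖t • (s • (y - x))‖ := norm_add_le _ _
      _ < δ' := by simp only [δ] at *; linarith
  have key := hr.add_fderiv_add_le (x := x) (y := x + s • (y - x)) (m := θ / 2) (fun t ht => by
    rw [add_sub_cancel_left]
    exact (hδ _ (hin t (Ioo_subset_Icc_self ht))).1 _)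
  have hy' : r (x + s • (y - x)) ≤ 0 := by
    have h1 := hin 1 (by simp)
    rw [one_smul] at h1
    refine (hδ _ h1).2.1 ?_
    exact hconv.add_smul_sub_mem hxΩ hy ⟨hs0.le, hs1⟩
  rw [add_sub_cancel_left, map_smul, norm_smul, Real.norm_of_nonneg hs0.le, hx0, smul_eq_mul]
    at key
  have : s * (fderiv ℝ r x (y - x) + θ / 4 * s * ‖y - x‖ ^ 2) ≤ s * 0 := by nlinarith
  have := le_of_mul_le_mul_left this hs0
  linarith

variable {E : Type*} [NormedAddCommGroup E] [InnerProductSpace ℝ E] [FiniteDimensional ℝ E]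

/-- `h` is a smooth global defining function for the boundary of `Ω`, and the tangent half-spaces
support `Ω` quadratically. -/
structure IsBoundaryDefining (Ω : Set E) (h : E → ℝ) : Prop where
  contDiff : ContDiff ℝ ∞ h
  eq_zero : ∀ x ∈ frontier Ω, h x = 0
  eventually_mem : ∀ x ∈ frontier Ω, ∀ᶠ y in 𝓝 x, h y ≤ 0 → y ∈ Ω
  support : ∃ κ : ℝ, 0 < κ ∧ ∀ x ∈ frontier Ω, ∀ y ∈ Ω,
    fderiv ℝ h x (y - x) ≤ -κ * ‖y - x‖ ^ 2

/-- Gluing with bump functions works because the support inequality is linear in the derivative, and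
at boundary points the derivatives of the bumps drop out. -/
theorem exists_isBoundaryDefining_of_local {Ω : Set E} (hcpt : IsCompact Ω)
    (hloc : ∀ x₀ ∈ frontier Ω, ∃ r : E → ℝ, ContDiff ℝ ∞ r ∧ ∃ δ : ℝ, 0 < δ ∧ ∃ κ : ℝ, 0 < κ ∧
      (∀ y ∈ ball x₀ δ, y ∈ Ω ↔ r y ≤ 0) ∧ ∀ x ∈ frontier Ω, x ∈ ball x₀ δ →
        r x = 0 ∧ ∀ y ∈ Ω, fderiv ℝ r x (y - x) ≤ -κ * ‖y - x‖ ^ 2) :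
    ∃ h : E → ℝ, IsBoundaryDefining Ω h := by
  have hloc' : ∀ x₀ ∈ frontier Ω, ∃ r : E → ℝ, ∃ ψ : E → ℝ, ∃ κ : ℝ, ContDiff ℝ ∞ r ∧
      ContDiff ℝ ∞ ψ ∧ (∀ y, 0 ≤ ψ y) ∧ 0 < ψ x₀ ∧ 0 < κ ∧
      (∀ y, ψ y ≠ 0 → (y ∈ Ω ↔ r y ≤ 0)) ∧ ∀ x ∈ frontier Ω, ψ x ≠ 0 →
        r x = 0 ∧ ∀ y ∈ Ω, fderiv ℝ r x (y - x) ≤ -κ * ‖y - x‖ ^ 2 := by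
    intro x₀ hx₀
    obtain ⟨r, hr, δ, hδ, κ, hκ, h1, h2⟩ := hloc x₀ hx₀
    let ψ : ContDiffBump x₀ := ⟨δ / 2, δ, by positivity, by linarith⟩
    have hsupp : ∀ y, ψ y ≠ 0 → y ∈ ball x₀ δ := fun y hy => by
      have : y ∈ Function.support ψ := hy
      rwa [ψ.support_eq] at this
    exact ⟨r, ψ, κ, hr, ψ.contDiff, fun y => ψ.nonneg, ψ.pos_of_mem_ball (mem_ball_self hδ), hκ,
      fun y hy => h1 y (hsupp y hy), fun x hx hx' => h2 x hx (hsupp x hx')⟩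
  choose! r ψ κ hr hψ hψ0 hψpos hκ hmem hsup using hloc'
  have hfc : IsCompact (frontier Ω) := hcpt.of_isClosed_subset isClosed_frontier
    hcpt.isClosed.frontier_subset
  obtain ⟨t, htF, hcov⟩ := hfc.elim_nhds_subcover (fun x => {y | 0 < ψ x y}) fun x hx =>
    (hψ x hx).continuous.continuousAt.eventually_const_lt (hψpos x hx)
  have hcov' : ∀ x ∈ frontier Ω, ∃ i ∈ t, 0 < ψ i x := fun x hx => by
    simpa using hcov hx
  have hderiv : ∀ x ∈ frontier Ω,
      HasFDerivAt (fun y => ∑ i ∈ t, ψ i y * r i y) (∑ i ∈ t, ψ i x • fderiv ℝ (r i) x) x := by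
    intro x hx
    refine HasFDerivAt.fun_sum fun i hi => ?_
    have hi' := htF i hi
    have := ((hψ i hi').hasFDerivAt_of_infty x).fun_mul ((hr i hi').hasFDerivAt_of_infty x)
    refine this.congr_fderiv ?_
    -- Either `ψ i` vanishes at `x`, which is then a minimum of it, so its derivative vanishes too;
    -- or `r i x = 0`.
    by_cases h0 : ψ i x = 0
    · have hmin : IsLocalMin (ψ i) x := Eventually.of_forall fun y => by
        rw [h0]; exact hψ0 i hi' y
      rw [hmin.fderiv_eq_zero, smul_zero, add_zero]
    · rw [(hsup i hi' x hx h0).1, zero_smul, add_zero]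
  refine ⟨fun y => ∑ i ∈ t, ψ i y * r i y, ?_, ?_, ?_, ?_⟩
  · exact ContDiff.sum fun i hi => (hψ i (htF i hi)).mul (hr i (htF i hi))
  · intro x hx
    refine Finset.sum_eq_zero fun i hi => ?_
    by_cases h0 : ψ i x = 0
    · rw [h0, zero_mul]
    · rw [(hsup i (htF i hi) x hx h0).1, mul_zero]
  · intro x hx
    obtain ⟨j, hj, hjx⟩ := hcov' x hx
    filter_upwards [(hψ j (htF j hj)).continuous.continuousAt.eventually_const_lt hjx] with y hy hle
    by_contra hyΩ
    have hpos : 0 < ∑ i ∈ t, ψ i y * r i y := by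
      refine Finset.sum_pos' (fun i hi => ?_) ⟨j, hj, ?_⟩
      · by_cases h0 : ψ i y = 0
        · rw [h0, zero_mul]
        · have := mt (hmem i (htF i hi) y h0).2 hyΩ
          exact mul_nonneg (hψ0 i (htF i hi) y) (not_le.1 this).le
      · have := mt (hmem j (htF j hj) y hy.ne').2 hyΩ
        exact mul_pos hy (not_le.1 this)
    linarith
  · obtain ⟨κ₀, hκ₀, H⟩ := hfc.exists_pos_forall_le (f := fun x => ∑ i ∈ t, ψ i x * κ i)
      (continuous_finsetSum _ fun i hi =>
        (hψ i (htF i hi)).continuous.mul continuous_const).continuousOn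
      (fun x hx => by
        obtain ⟨j, hj, hjx⟩ := hcov' x hx
        exact Finset.sum_pos' (fun i hi => mul_nonneg (hψ0 i (htF i hi) x) (hκ i (htF i hi)).le)
          ⟨j, hj, mul_pos hjx (hκ j (htF j hj))⟩)
    refine ⟨κ₀, hκ₀, fun x hx y hy => ?_⟩
    rw [(hderiv x hx).fderiv]
    simp only [sum_apply, smul_apply, smul_eq_mul]
    calc ∑ i ∈ t, ψ i x * fderiv ℝ (r i) x (y - x)
        ≤ ∑ i ∈ t, ψ i x * (-κ i * ‖y - x‖ ^ 2) := by
          refine Finset.sum_le_sum fun i hi => ?_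
          by_cases h0 : ψ i x = 0
          · rw [h0, zero_mul, zero_mul]
          · exact mul_le_mul_of_nonneg_left ((hsup i (htF i hi) x hx h0).2 y hy)
              (hψ0 i (htF i hi) x)
      _ = -(∑ i ∈ t, ψ i x * κ i) * ‖y - x‖ ^ 2 := by
          rw [← Finset.sum_neg_distrib, Finset.sum_mul]
          exact Finset.sum_congr rfl fun i _ => by ring
      _ ≤ -κ₀ * ‖y - x‖ ^ 2 := by
          have := H x hx
          gcongr

/-- The Hessian of a boundary defining function is positive in tangential directions. -/
theorem IsBoundaryDefining.fderiv_fderiv_pos {Ω : Set E} {h : E → ℝ}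
    (hh : IsBoundaryDefining Ω h) {x : E} (hx : x ∈ frontier Ω) {w : E} (hw : w ≠ 0)
    (hw0 : fderiv ℝ h x w = 0) (hne : gradient h x ≠ 0) :
    0 < fderiv ℝ (fderiv ℝ h) x w w := by
  obtain ⟨κ, hκ, hs⟩ := hh.support
  by_contra! hle
  set g := gradient h x
  have hg : ∀ v, fderiv ℝ h x v = inner ℝ g v := fun v => (inner_gradient_left).symm
  have hg0 : 0 < ‖g‖ := norm_pos_iff.2 hne
  have hw1 : 0 < ‖w‖ := norm_pos_iff.2 hw
  -- With this `K` the parabola `x + t w - t² K g` enters `Ω`, yet it descends below the tangent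
  -- plane by only half of what quadratic support demands.
  set K := κ * ‖w‖ ^ 2 / (2 * ‖g‖ ^ 2)
  have hK : 0 < K := by positivity
  have hKg : K * ‖g‖ ^ 2 = κ * ‖w‖ ^ 2 / 2 := by
    simp only [K]; field_simp
  have hgg : fderiv ℝ h x (K • g) = κ * ‖w‖ ^ 2 / 2 := by
    rw [hg, real_inner_smul_right, real_inner_self_eq_norm_sq, hKg]
  have hev := hh.contDiff.eventually_parabola_nonpos (p := K • g) (hh.eq_zero x hx) hw0
    (by rw [hgg]; exact hle.trans_lt (by positivity))
  have hc : Tendsto (fun t : ℝ => x + t • w - t ^ 2 • (K • g)) (𝓝 0) (𝓝 x) := by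
    have : Continuous fun t : ℝ => x + t • w - t ^ 2 • (K • g) := by fun_prop
    simpa using this.tendsto 0
  obtain ⟨t, ⟨ht, ht'⟩, ht0⟩ := ((hev.and (hc.eventually (hh.eventually_mem x hx))).filter_mono
    nhdsWithin_le_nhds |>.and (self_mem_nhdsWithin : Ioi (0 : ℝ) ∈ 𝓝[>] (0 : ℝ))).exists
  have ht0' : (0 : ℝ) < t := ht0
  have h1 := hs x hx _ (ht' ht)
  have e1 : x + t • w - t ^ 2 • (K • g) - x = t • w - t ^ 2 • (K • g) := by abel
  have e2 : ‖t • w - t ^ 2 • (K • g)‖ ^ 2 = t ^ 2 * ‖w‖ ^ 2 + ‖t ^ 2 • (K • g)‖ ^ 2 := by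
    rw [norm_sub_sq_real, real_inner_smul_left, real_inner_smul_right, real_inner_smul_right,
      real_inner_comm, ← hg, hw0, norm_smul, Real.norm_of_nonneg ht0'.le]
    ring
  rw [e1, e2, map_sub, map_smul, map_smul, hw0, hgg, smul_zero, zero_sub, smul_eq_mul] at h1
  have h2 : 0 ≤ ‖t ^ 2 • (K • g)‖ ^ 2 := by positivity
  have h3 : 0 < t ^ 2 * (κ * ‖w‖ ^ 2) := by positivity
  nlinarith

/-- A boundary defining function, with positive definite Hessian at the boundary. -/
structure IsStrictBoundaryDefining (Ω : Set E) (h : E → ℝ) : Prop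
    extends IsBoundaryDefining Ω h where
  gradient_ne_zero : ∀ x ∈ frontier Ω, gradient h x ≠ 0
  hessian_pos : ∃ θ : ℝ, 0 < θ ∧ ∀ x ∈ frontier Ω, ∀ v,
    θ * ‖v‖ ^ 2 ≤ fderiv ℝ (fderiv ℝ h) x v v

theorem IsBoundaryDefining.gradient_ne_zero' {Ω : Set E} {h : E → ℝ}
    (hh : IsBoundaryDefining Ω h) (hint : (interior Ω).Nonempty) {x : E}
    (hx : x ∈ frontier Ω) : gradient h x ≠ 0 := by
  intro h0
  obtain ⟨κ, hκ, hs⟩ := hh.support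
  obtain ⟨y, hy⟩ := hint
  have hne : y ≠ x := by
    rintro rfl
    exact hx.2 hy
  have h1 := hs x hx y (interior_subset hy)
  rw [← inner_gradient_left, h0, inner_zero_left] at h1
  have : 0 < ‖y - x‖ := norm_pos_iff.2 (sub_ne_zero.2 hne)
  have : 0 < κ * ‖y - x‖ ^ 2 := by positivity
  linarith

/-- The Hessian of `h` is positive on the tangent spaces; passing to `h + A h²` makes it positive in
the normal direction too. -/
theorem IsBoundaryDefining.exists_isStrictBoundaryDefining {Ω : Set E} (hcpt : IsCompact Ω)
    (hint : (interior Ω).Nonempty) {h : E → ℝ} (hh : IsBoundaryDefining Ω h) :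
    ∃ h : E → ℝ, IsStrictBoundaryDefining Ω h := by
  have hfc : IsCompact (frontier Ω) := hcpt.of_isClosed_subset isClosed_frontier
    hcpt.isClosed.frontier_subset
  obtain ⟨A, hA, θ, hθ, H⟩ := hfc.exists_pos_mul_sq_le_of_forall_ker
    (Q := fderiv ℝ (fderiv ℝ h)) (l := fderiv ℝ h)
    hh.contDiff.continuous_fderiv_fderiv.continuousOn
    (hh.contDiff.continuous_fderiv (by simp)).continuousOn
    fun x hx v hv hv0 => hh.fderiv_fderiv_pos hx hv hv0 (hh.gradient_ne_zero' hint hx)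
  have hd : ∀ x ∈ frontier Ω, fderiv ℝ (fun y => h y + A * h y ^ 2) x = fderiv ℝ h x := by
    intro x hx
    rw [fderiv_add_const_mul_sq hh.contDiff, hh.eq_zero x hx]
    simp
  have hb : IsBoundaryDefining Ω (fun y => h y + A * h y ^ 2) := by
    refine ⟨hh.contDiff.add (contDiff_const.mul (hh.contDiff.pow 2)), ?_, ?_, ?_⟩
    · intro x hx
      simp [hh.eq_zero x hx]
    · intro x hx
      -- Here `1 + A h > 0`, so `h + A h² = h (1 + A h)` has the sign of `h`.
      have h1 : ∀ᶠ y in 𝓝 x, -1 < A * h y := by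
        have : Continuous fun y => A * h y := continuous_const.mul hh.contDiff.continuous
        refine this.continuousAt.eventually_const_lt ?_
        simp [hh.eq_zero x hx]
      filter_upwards [hh.eventually_mem x hx, h1] with y hy hy' hle
      refine hy ?_
      by_contra! hpos
      nlinarith
    · obtain ⟨κ, hκ, hs⟩ := hh.support
      exact ⟨κ, hκ, fun x hx y hy => by rw [hd x hx]; exact hs x hx y hy⟩
  refine ⟨_, hb, fun x hx => hb.gradient_ne_zero' hint hx, θ, hθ, fun x hx v => ?_⟩
  rw [fderiv_fderiv_add_const_mul_sq hh.contDiff, hh.eq_zero x hx]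
  have := H x hx v
  nlinarith [mul_nonneg hA (sq_nonneg (fderiv ℝ h x v))]

end ConvexDomain

theorem IsUniformlyConvexDomain.exists_isStrictBoundaryDefining {n : ℕ}
    {Ω : Set (EuclideanSpace ℝ (Fin n))} (hΩ : IsUniformlyConvexDomain Ω) :
    ∃ h, IsStrictBoundaryDefining Ω h := by
  open Filter Topology Metric Set in
  obtain ⟨h, hh⟩ : ∃ h, IsBoundaryDefining Ω h := by
    refine exists_isBoundaryDefining_of_local hΩ.isCompact fun x₀ hx₀ => ?_
    obtain ⟨κ, hκ, H⟩ := hΩ.smooth_boundary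
    obtain ⟨ρ, hρ, hρ0, hmem, hcurv⟩ := H x₀ hx₀
    have hx0 : ρ x₀ = 0 := eq_zero_of_mem_frontier_of_eventually_iff hΩ.isCompact.isClosed hx₀
      hρ.continuous hmem
    -- The curvature bound is used at the single point `x₀`; `exists_ball_support` spreads
    -- positivity to a neighbourhood.
    obtain ⟨A, hA, θ, hθ, hpos⟩ := (isCompact_singleton (x := x₀)).exists_pos_mul_sq_le_of_forall_ker
      (Q := fderiv ℝ (fderiv ℝ ρ)) (l := fderiv ℝ ρ)
      hρ.continuous_fderiv_fderiv.continuousOn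
      (hρ.continuous_fderiv (by simp)).continuousOn (by
        rintro x rfl v hv hv0
        have h1 : 0 < ‖fderiv ℝ ρ x‖ := norm_pos_iff.2 hρ0
        have h2 : 0 < ‖v‖ := norm_pos_iff.2 hv
        exact lt_of_lt_of_le (by positivity) (hcurv v hv0))
    have hr : ContDiff ℝ ∞ (fun y => ρ y + A * ρ y ^ 2) :=
      hρ.add (contDiff_const.mul (hρ.pow 2))
    refine ⟨_, hr, exists_ball_support hΩ.isCompact hΩ.convex hr hθ (fun v => ?_) ?_⟩
    · rw [fderiv_fderiv_add_const_mul_sq hρ, hx0]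
      have := hpos x₀ rfl v
      nlinarith [mul_nonneg hA (sq_nonneg (fderiv ℝ ρ x₀ v))]
    · have h1 : ∀ᶠ y in 𝓝 x₀, -1 < A * ρ y := by
        have : Continuous fun y => A * ρ y := continuous_const.mul hρ.continuous
        refine this.continuousAt.eventually_const_lt ?_
        simp [hx0]
      filter_upwards [hmem, h1] with y hy hy'
      rw [hy]
      have e : ρ y + A * ρ y ^ 2 = ρ y * (1 + A * ρ y) := by ring
      rw [e]
      constructor
      · intro h
        exact mul_nonpos_of_nonpos_of_nonneg h (by linarith)
      · intro h
        by_contra! hpos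
        have : 0 < ρ y * (1 + A * ρ y) := mul_pos hpos (by linarith)
        linarith
  exact hh.exists_isStrictBoundaryDefining hΩ.isCompact hΩ.nonempty_interior

/-! ### Concavity of the angle on positive matrices. -/

section Arctan

open Set

theorem Real.concaveOn_arctan : ConcaveOn ℝ (Ici 0) Real.arctan := by
  refine AntitoneOn.concaveOn_of_deriv (convex_Ici 0) Real.continuous_arctan.continuousOn
    Real.differentiable_arctan.differentiableOn ?_
  intro a ha b hb hab
  rw [interior_Ici] at ha hb
  simp only [Real.deriv_arctan]
  have : (0 : ℝ) < a := ha
  gcongr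

theorem Real.arctan_le_add_div {l m : ℝ} (hl : 0 ≤ l) (hm : 0 ≤ m) :
    Real.arctan m ≤ Real.arctan l + (m - l) * (1 / (1 + l ^ 2)) := by
  have hd := Real.hasDerivAt_arctan l
  rcases lt_trichotomy l m with h | rfl | h
  · have := Real.concaveOn_arctan.slope_le_of_hasDerivAt (mem_Ici.2 hl) (mem_Ici.2 hm) h hd
    rw [slope_def_field, div_le_iff₀ (by linarith)] at this
    linarith
  · simp
  · have := Real.concaveOn_arctan.le_slope_of_hasDerivAt (mem_Ici.2 hm) (mem_Ici.2 hl) h hd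
    rw [slope_def_field, le_div_iff₀ (by linarith)] at this
    linarith

theorem Real.arctan_le_self {m : ℝ} (hm : 0 ≤ m) : Real.arctan m ≤ m := by
  simpa using Real.arctan_le_add_div le_rfl hm

/-- Averaging over a doubly stochastic matrix, `∑ arctan` lies below its linearization. -/
theorem sum_div_mul_sub_nonneg_of_doublyStochastic {ι : Type*} [Fintype ι] {l m : ι → ℝ}
    (hl : ∀ k, 0 ≤ l k) (hm : ∀ k, 0 ≤ m k)
    (hlm : ∑ k, Real.arctan (l k) = ∑ k, Real.arctan (m k)) {p : ι → ι → ℝ}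
    (hp : ∀ k j, 0 ≤ p k j) (hrow : ∀ k, ∑ j, p k j = 1) (hcol : ∀ j, ∑ k, p k j = 1) :
    0 ≤ ∑ k, 1 / (1 + l k ^ 2) * ((∑ j, m j * p k j) - l k) := by
  -- Tangent line inequalities at `l k`, averaged with weights `p k j`; unit column sums restore `∑
  -- arctan (m j)`, which cancels against `∑ arctan (l k)`.
  have h1 : ∑ k, ∑ j, p k j * Real.arctan (m j) ≤
      ∑ k, ∑ j, p k j * (Real.arctan (l k) + (m j - l k) * (1 / (1 + l k ^ 2))) :=
    Finset.sum_le_sum fun k _ => Finset.sum_le_sum fun j _ =>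
      mul_le_mul_of_nonneg_left (Real.arctan_le_add_div (hl k) (hm j)) (hp k j)
  have h2 : ∑ k, ∑ j, p k j * Real.arctan (m j) = ∑ j, Real.arctan (m j) := by
    rw [Finset.sum_comm]
    refine Finset.sum_congr rfl fun j _ => ?_
    rw [← Finset.sum_mul, hcol, one_mul]
  have h3 : ∀ k, ∑ j, p k j * (Real.arctan (l k) + (m j - l k) * (1 / (1 + l k ^ 2))) =
      Real.arctan (l k) + 1 / (1 + l k ^ 2) * ((∑ j, m j * p k j) - l k) := by
    intro k
    have : ∀ j, p k j * (Real.arctan (l k) + (m j - l k) * (1 / (1 + l k ^ 2))) =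
        p k j * (Real.arctan (l k) - l k * (1 / (1 + l k ^ 2))) +
          1 / (1 + l k ^ 2) * (m j * p k j) := fun j => by ring
    simp_rw [this]
    rw [Finset.sum_add_distrib, ← Finset.sum_mul, ← Finset.mul_sum, hrow]
    ring
  simp_rw [h3] at h1
  rw [h2, Finset.sum_add_distrib, hlm] at h1
  linarith

end Arctan

/-! ### Lagrangian maps, symmetries of their derivatives and the linearized equation. -/

section LagrangianMap

open Filter Topology Metric Set
open scoped RealInnerProductSpace

variable {E : Type*} [NormedAddCommGroup E] [InnerProductSpace ℝ E]

/-- `f` is a smooth map between compact convex domains, up to the boundary, whose derivative is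
symmetric and positive with constant Lagrangian angle `c`. -/
structure IsLagrangianMap (n : ℕ) (Ω Ω' : Set E) (f : E → E) (c : ℝ) : Prop where
  isCompact : IsCompact Ω
  convex : Convex ℝ Ω
  nonempty_interior : (interior Ω).Nonempty
  isCompact' : IsCompact Ω'
  contDiffOn : ContDiffOn ℝ ∞ f Ω
  mapsTo : MapsTo f Ω Ω'
  mapsTo_frontier : MapsTo f (frontier Ω) (frontier Ω')
  eigen : ∀ x ∈ Ω, ∃ (e : OrthonormalBasis (Fin n) ℝ E) (l : Fin n → ℝ), (∀ k, 0 < l k) ∧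
    (∀ k, fderivWithin ℝ f Ω x (e k) = l k • e k) ∧ ∑ k, Real.arctan (l k) = c

theorem OrthonormalBasis.inner_map_eq_sum {ι : Type*} [Fintype ι] (e : OrthonormalBasis ι ℝ E)
    {L : E →L[ℝ] E} {l : ι → ℝ} (h : ∀ k, L (e k) = l k • e k) (v w : E) :
    ⟪L v, w⟫ = ∑ k, l k * (⟪e k, v⟫ * ⟪e k, w⟫) := by
  conv_lhs => rw [← e.sum_repr' v]
  rw [map_sum, sum_inner]
  refine Finset.sum_congr rfl fun k _ => ?_
  rw [map_smul, h, real_inner_smul_left, real_inner_smul_left]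
  ring

theorem OrthonormalBasis.sum_inner_sq {ι : Type*} [Fintype ι] (e : OrthonormalBasis ι ℝ E)
    (v : E) : ∑ k, ⟪e k, v⟫ ^ 2 = ‖v‖ ^ 2 := by
  simpa using e.sum_sq_norm_inner_right v

/-- Allows identities valid on `Ω` to be differentiated up to its boundary. -/
theorem HasFDerivWithinAt.apply_eq_zero_of_eqOn_zero {F : Type*} [NormedAddCommGroup F]
    [NormedSpace ℝ F] {s : Set E} (hs : UniqueDiffOn ℝ s) {x : E} (hx : x ∈ s) {φ : E → F}
    {φ' : E →L[ℝ] F} (hφ : HasFDerivWithinAt φ φ' s x) (h0 : ∀ y ∈ s, φ y = 0) (v : E) :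
    φ' v = 0 := by
  have h1 : HasFDerivWithinAt φ (0 : E →L[ℝ] F) s x :=
    (hasFDerivWithinAt_const (0 : F) x s).congr h0 (h0 x hx)
  rw [(hs x hx).eq hφ h1]
  rfl

theorem eventually_hasDerivAt_line {F : Type*} [NormedAddCommGroup F] [NormedSpace ℝ F]
    {s : Set E} {φ : E → F} {φ' : E → E →L[ℝ] F} (hφ : ∀ y ∈ s, HasFDerivWithinAt φ (φ' y) s y)
    {x : E} (hx : x ∈ interior s) (v : E) :
    ∀ᶠ t : ℝ in 𝓝 0, HasDerivAt (fun t : ℝ => φ (x + t • v)) (φ' (x + t • v) v) t := by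
  have hc : Tendsto (fun t : ℝ => x + t • v) (𝓝 0) (𝓝 x) := by
    have : Continuous fun t : ℝ => x + t • v := by fun_prop
    simpa using this.tendsto 0
  filter_upwards [hc.eventually (isOpen_interior.mem_nhds hx)] with t ht
  have h1 : HasFDerivAt φ (φ' (x + t • v)) (x + t • v) :=
    (hφ _ (interior_subset ht)).hasFDerivAt (mem_interior_iff_mem_nhds.1 ht)
  have h2 : HasDerivAt (fun t : ℝ => x + t • v) v t := by
    simpa using ((hasDerivAt_id t).smul_const v).const_add x
  exact h1.comp_hasDerivAt t h2

namespace IsLagrangianMap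

variable {n : ℕ} {Ω Ω' : Set E} {f : E → E} {c : ℝ}

theorem uniqueDiffOn (hf : IsLagrangianMap n Ω Ω' f c) : UniqueDiffOn ℝ Ω :=
  uniqueDiffOn_convex hf.convex hf.nonempty_interior

theorem contDiffOn_fderivWithin (hf : IsLagrangianMap n Ω Ω' f c) :
    ContDiffOn ℝ ∞ (fderivWithin ℝ f Ω) Ω :=
  hf.contDiffOn.fderivWithin hf.uniqueDiffOn (by simp)

theorem contDiffOn_fderivWithin_fderivWithin (hf : IsLagrangianMap n Ω Ω' f c) :
    ContDiffOn ℝ ∞ (fderivWithin ℝ (fderivWithin ℝ f Ω) Ω) Ω :=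
  hf.contDiffOn_fderivWithin.fderivWithin hf.uniqueDiffOn (by simp)

theorem hasFDerivWithinAt (hf : IsLagrangianMap n Ω Ω' f c) {x : E} (hx : x ∈ Ω) :
    HasFDerivWithinAt f (fderivWithin ℝ f Ω x) Ω x :=
  (hf.contDiffOn.differentiableOn (by simp) x hx).hasFDerivWithinAt

theorem hasFDerivWithinAt₂ (hf : IsLagrangianMap n Ω Ω' f c) {x : E} (hx : x ∈ Ω) :
    HasFDerivWithinAt (fderivWithin ℝ f Ω) (fderivWithin ℝ (fderivWithin ℝ f Ω) Ω x) Ω x :=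
  (hf.contDiffOn_fderivWithin.differentiableOn (by simp) x hx).hasFDerivWithinAt

theorem hasFDerivWithinAt₃ (hf : IsLagrangianMap n Ω Ω' f c) {x : E} (hx : x ∈ Ω) :
    HasFDerivWithinAt (fderivWithin ℝ (fderivWithin ℝ f Ω) Ω)
      (fderivWithin ℝ (fderivWithin ℝ (fderivWithin ℝ f Ω) Ω) Ω x) Ω x :=
  (hf.contDiffOn_fderivWithin_fderivWithin.differentiableOn (by simp) x hx).hasFDerivWithinAt

theorem subset_closure_interior (hf : IsLagrangianMap n Ω Ω' f c) {x : E} (hx : x ∈ Ω) :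
    x ∈ closure (interior Ω) := by
  rw [hf.convex.closure_interior_eq_closure_of_nonempty_interior hf.nonempty_interior]
  exact subset_closure hx

theorem inner_fderivWithin_comm (hf : IsLagrangianMap n Ω Ω' f c) {x : E} (hx : x ∈ Ω)
    (v w : E) : ⟪fderivWithin ℝ f Ω x v, w⟫ = ⟪fderivWithin ℝ f Ω x w, v⟫ := by
  obtain ⟨e, l, -, h, -⟩ := hf.eigen x hx
  rw [e.inner_map_eq_sum h, e.inner_map_eq_sum h]
  exact Finset.sum_congr rfl fun k _ => by ring

theorem inner_fderivWithin_self_nonneg (hf : IsLagrangianMap n Ω Ω' f c) {x : E} (hx : x ∈ Ω)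
    (v : E) : 0 ≤ ⟪fderivWithin ℝ f Ω x v, v⟫ := by
  obtain ⟨e, l, hl, h, -⟩ := hf.eigen x hx
  rw [e.inner_map_eq_sum h]
  exact Finset.sum_nonneg fun k _ => mul_nonneg (hl k).le (mul_self_nonneg _)

theorem inner_fderivWithin_self_pos (hf : IsLagrangianMap n Ω Ω' f c) {x : E} (hx : x ∈ Ω)
    {v : E} (hv : v ≠ 0) : 0 < ⟪fderivWithin ℝ f Ω x v, v⟫ := by
  refine lt_of_le_of_ne (hf.inner_fderivWithin_self_nonneg hx v) fun h0 => hv ?_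
  obtain ⟨e, l, hl, h, -⟩ := hf.eigen x hx
  rw [e.inner_map_eq_sum h, eq_comm, Finset.sum_eq_zero_iff_of_nonneg
    fun k _ => mul_nonneg (hl k).le (mul_self_nonneg _)] at h0
  have h1 : ‖v‖ ^ 2 = 0 := by
    rw [← e.sum_inner_sq]
    refine Finset.sum_eq_zero fun k hk => ?_
    rcases mul_eq_zero.1 (h0 k hk) with h2 | h2
    · exact absurd h2 (hl k).ne'
    · rw [sq, h2]
  simpa using h1

theorem second_symm (hf : IsLagrangianMap n Ω Ω' f c) {x : E} (hx : x ∈ Ω) (v w : E) :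
    fderivWithin ℝ (fderivWithin ℝ f Ω) Ω x v w = fderivWithin ℝ (fderivWithin ℝ f Ω) Ω x w v :=
  (hf.contDiffOn x hx).isSymmSndFDerivWithinAt
    (by simpa using WithTop.coe_le_coe.2 (le_top : (2 : ℕ∞) ≤ ⊤)) hf.uniqueDiffOn
    (hf.subset_closure_interior hx) hx v w

/-- Obtained by differentiating the symmetry of `Df`. With `second_symm` it makes the trilinear form
totally symmetric, as for third derivatives of a potential. -/
theorem second_inner_symm (hf : IsLagrangianMap n Ω Ω' f c) {x : E} (hx : x ∈ Ω) (v w z : E) :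
    ⟪fderivWithin ℝ (fderivWithin ℝ f Ω) Ω x v w, z⟫ =
      ⟪fderivWithin ℝ (fderivWithin ℝ f Ω) Ω x v z, w⟫ := by
  have hA := hf.hasFDerivWithinAt₂ hx
  have h1 := (hA.clm_apply (hasFDerivWithinAt_const w x Ω)).inner ℝ
    (hasFDerivWithinAt_const z x Ω)
  have h2 := (hA.clm_apply (hasFDerivWithinAt_const z x Ω)).inner ℝ
    (hasFDerivWithinAt_const w x Ω)
  have := (h1.fun_sub h2).apply_eq_zero_of_eqOn_zero hf.uniqueDiffOn hx
    (fun y hy => sub_eq_zero.2 (hf.inner_fderivWithin_comm hy w z)) v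
  simpa [sub_eq_zero] using this

theorem third_symm (hf : IsLagrangianMap n Ω Ω' f c) {x : E} (hx : x ∈ Ω) (u v w : E) :
    fderivWithin ℝ (fderivWithin ℝ (fderivWithin ℝ f Ω) Ω) Ω x u v w =
      fderivWithin ℝ (fderivWithin ℝ (fderivWithin ℝ f Ω) Ω) Ω x v u w := by
  have := (hf.contDiffOn_fderivWithin x hx).isSymmSndFDerivWithinAt
    (by simpa using WithTop.coe_le_coe.2 (le_top : (2 : ℕ∞) ≤ ⊤)) hf.uniqueDiffOn
    (hf.subset_closure_interior hx) hx u v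
  rw [this]

theorem third_symm' (hf : IsLagrangianMap n Ω Ω' f c) {x : E} (hx : x ∈ Ω) (u v w : E) :
    fderivWithin ℝ (fderivWithin ℝ (fderivWithin ℝ f Ω) Ω) Ω x u v w =
      fderivWithin ℝ (fderivWithin ℝ (fderivWithin ℝ f Ω) Ω) Ω x u w v := by
  have hB := hf.hasFDerivWithinAt₃ hx
  have h1 := (hB.clm_apply (hasFDerivWithinAt_const v x Ω)).clm_apply
    (hasFDerivWithinAt_const w x Ω)
  have h2 := (hB.clm_apply (hasFDerivWithinAt_const w x Ω)).clm_apply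
    (hasFDerivWithinAt_const v x Ω)
  have := (h1.fun_sub h2).apply_eq_zero_of_eqOn_zero hf.uniqueDiffOn hx
    (fun y hy => sub_eq_zero.2 (hf.second_symm hy v w)) u
  simpa [sub_eq_zero] using this

theorem third_inner_symm (hf : IsLagrangianMap n Ω Ω' f c) {x : E} (hx : x ∈ Ω)
    (u v w z : E) :
    ⟪fderivWithin ℝ (fderivWithin ℝ (fderivWithin ℝ f Ω) Ω) Ω x u v w, z⟫ =
      ⟪fderivWithin ℝ (fderivWithin ℝ (fderivWithin ℝ f Ω) Ω) Ω x u v z, w⟫ := by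
  have hB := hf.hasFDerivWithinAt₃ hx
  have h1 := ((hB.clm_apply (hasFDerivWithinAt_const v x Ω)).clm_apply
    (hasFDerivWithinAt_const w x Ω)).inner ℝ (hasFDerivWithinAt_const z x Ω)
  have h2 := ((hB.clm_apply (hasFDerivWithinAt_const v x Ω)).clm_apply
    (hasFDerivWithinAt_const z x Ω)).inner ℝ (hasFDerivWithinAt_const w x Ω)
  have := (h1.fun_sub h2).apply_eq_zero_of_eqOn_zero hf.uniqueDiffOn hx
    (fun y hy => sub_eq_zero.2 (hf.second_inner_symm hy v w z)) u
  simpa [sub_eq_zero] using this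

/-- This exchange converts the equation differentiated twice along `w` into a statement about `L ⟨Df
w, w⟩`. -/
theorem third_inner_swap (hf : IsLagrangianMap n Ω Ω' f c) {x : E} (hx : x ∈ Ω) (e w : E) :
    ⟪fderivWithin ℝ (fderivWithin ℝ (fderivWithin ℝ f Ω) Ω) Ω x e e w, w⟫ =
      ⟪fderivWithin ℝ (fderivWithin ℝ (fderivWithin ℝ f Ω) Ω) Ω x w w e, e⟫ := by
  rw [hf.third_symm' hx e e w, hf.third_symm hx e w e, hf.third_inner_symm hx w e e w,
    hf.third_symm' hx w e w]

/-- By concavity of `arctan`, the linearized operator evaluated on `D f` is minimal at the point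
of linearization. -/
theorem sum_mul_inner_sub_nonneg (hf : IsLagrangianMap n Ω Ω' f c) {y : E} (hy : y ∈ Ω)
    (e : OrthonormalBasis (Fin n) ℝ E) {l : Fin n → ℝ} (hl : ∀ k, 0 < l k)
    (hc : ∑ k, Real.arctan (l k) = c) :
    0 ≤ ∑ k, 1 / (1 + l k ^ 2) * (⟪fderivWithin ℝ f Ω y (e k), e k⟫ - l k) := by
  obtain ⟨g, m, hm, h, hmc⟩ := hf.eigen y hy
  -- Squared inner products between two orthonormal bases form a doubly stochastic matrix.
  have := sum_div_mul_sub_nonneg_of_doublyStochastic (fun k => (hl k).le) (fun k => (hm k).le)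
    (hc.trans hmc.symm) (p := fun k j => ⟪g j, e k⟫ ^ 2) (fun _ _ => sq_nonneg _)
    (fun k => by rw [g.sum_inner_sq]; simp)
    (fun j => by
      simp_rw [real_inner_comm (e _) (g j)]
      rw [e.sum_inner_sq]; simp)
  convert this using 5 with k
  rw [g.inner_map_eq_sum h]
  exact Finset.sum_congr rfl fun k _ => by ring

variable {x : E} {e : OrthonormalBasis (Fin n) ℝ E} {l : Fin n → ℝ}

/-- With the weights frozen at `x`, the sum in `sum_mul_inner_sub_nonneg` is nonnegative along the
line `x + t v` and vanishes at `t = 0`. The first and second order conditions at this minimum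
replace two differentiations of the angle. -/
theorem sum_second_inner_eq_zero_and_sum_third_nonneg (hf : IsLagrangianMap n Ω Ω' f c)
    (hx : x ∈ interior Ω) (hl : ∀ k, 0 < l k)
    (he : ∀ k, fderivWithin ℝ f Ω x (e k) = l k • e k)
    (hc : ∑ k, Real.arctan (l k) = c) (v : E) :
    ∑ k, 1 / (1 + l k ^ 2) * ⟪fderivWithin ℝ (fderivWithin ℝ f Ω) Ω x v (e k), e k⟫ = 0 ∧
    0 ≤ ∑ k, 1 / (1 + l k ^ 2) *
      ⟪fderivWithin ℝ (fderivWithin ℝ (fderivWithin ℝ f Ω) Ω) Ω x v v (e k), e k⟫ := by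
  have h1 := eventually_hasDerivAt_line (fun y hy => hf.hasFDerivWithinAt₂ hy) hx v
  have h2 := eventually_hasDerivAt_line
    (φ' := fderivWithin ℝ (fderivWithin ℝ (fderivWithin ℝ f Ω) Ω) Ω)
    (fun y hy => hf.hasFDerivWithinAt₃ hy) hx v
  have h1' : ∀ᶠ t : ℝ in 𝓝 0, HasDerivAt
      (fun t : ℝ => -∑ k, 1 / (1 + l k ^ 2) * (⟪fderivWithin ℝ f Ω (x + t • v) (e k), e k⟫ - l k))
      (-∑ k, 1 / (1 + l k ^ 2) *
        ⟪fderivWithin ℝ (fderivWithin ℝ f Ω) Ω (x + t • v) v (e k), e k⟫) t := by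
    filter_upwards [h1] with t ht
    refine (HasDerivAt.fun_sum fun k _ => ?_).fun_neg
    have := (ht.clm_apply (hasDerivAt_const t (e k))).inner ℝ (hasDerivAt_const t (e k))
    have := (this.sub_const (l k)).const_mul (1 / (1 + l k ^ 2))
    simpa using this
  have h2' : HasDerivAt (fun t : ℝ => -∑ k, 1 / (1 + l k ^ 2) *
      ⟪fderivWithin ℝ (fderivWithin ℝ f Ω) Ω (x + t • v) v (e k), e k⟫)
      (-∑ k, 1 / (1 + l k ^ 2) *
        ⟪fderivWithin ℝ (fderivWithin ℝ (fderivWithin ℝ f Ω) Ω) Ω x v v (e k), e k⟫) 0 := by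
    refine (HasDerivAt.fun_sum fun k _ => ?_).fun_neg
    have := ((h2.self_of_nhds.clm_apply (hasDerivAt_const (0 : ℝ) v)).clm_apply
      (hasDerivAt_const (0 : ℝ) (e k))).inner ℝ (hasDerivAt_const (0 : ℝ) (e k))
    have := this.const_mul (1 / (1 + l k ^ 2))
    simpa using this
  have hmax : IsLocalMax (fun t : ℝ => -∑ k, 1 / (1 + l k ^ 2) *
      (⟪fderivWithin ℝ f Ω (x + t • v) (e k), e k⟫ - l k)) 0 := by
    have hcont : Tendsto (fun t : ℝ => x + t • v) (𝓝 0) (𝓝 x) := by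
      have : Continuous fun t : ℝ => x + t • v := by fun_prop
      simpa using this.tendsto 0
    filter_upwards [hcont.eventually (isOpen_interior.mem_nhds hx)] with t ht
    have h0 : ∑ k, 1 / (1 + l k ^ 2) *
        (⟪fderivWithin ℝ f Ω (x + (0 : ℝ) • v) (e k), e k⟫ - l k) = 0 := by
      refine Finset.sum_eq_zero fun k _ => ?_
      rw [zero_smul, add_zero, he, real_inner_smul_left, real_inner_self_eq_norm_sq]
      simp
    rw [h0, neg_zero, neg_nonpos]
    exact hf.sum_mul_inner_sub_nonneg (interior_subset ht) e hl hc
  constructor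
  · have := hmax.hasDerivAt_eq_zero h1'.self_of_nhds
    simpa using this
  · have := hmax.second_deriv_nonpos h1' h2'
    linarith

/-- The once differentiated equation, read through total symmetry as `L f = 0`; it removes first
order terms in `Φ(y, f y)`. -/
theorem sum_smul_second_eq_zero (hf : IsLagrangianMap n Ω Ω' f c)
    (hx : x ∈ interior Ω) (hl : ∀ k, 0 < l k)
    (he : ∀ k, fderivWithin ℝ f Ω x (e k) = l k • e k)
    (hc : ∑ k, Real.arctan (l k) = c) :
    ∑ k, (1 / (1 + l k ^ 2)) • fderivWithin ℝ (fderivWithin ℝ f Ω) Ω x (e k) (e k) = 0 := by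
  have hxΩ := interior_subset hx
  refine ext_inner_right ℝ fun v => ?_
  rw [inner_zero_left, sum_inner,
    ← (hf.sum_second_inner_eq_zero_and_sum_third_nonneg hx hl he hc v).1]
  refine Finset.sum_congr rfl fun k _ => ?_
  rw [real_inner_smul_left, hf.second_inner_symm hxΩ, hf.second_symm hxΩ]

theorem sum_third_nonneg (hf : IsLagrangianMap n Ω Ω' f c)
    (hx : x ∈ interior Ω) (hl : ∀ k, 0 < l k)
    (he : ∀ k, fderivWithin ℝ f Ω x (e k) = l k • e k)
    (hc : ∑ k, Real.arctan (l k) = c) (w : E) :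
    0 ≤ ∑ k, 1 / (1 + l k ^ 2) *
      ⟪fderivWithin ℝ (fderivWithin ℝ (fderivWithin ℝ f Ω) Ω) Ω x (e k) (e k) w, w⟫ := by
  have h := (hf.sum_second_inner_eq_zero_and_sum_third_nonneg hx hl he hc w).2
  simp_rw [fun k => hf.third_inner_swap (interior_subset hx) (e k) w]
  exact h

end IsLagrangianMap

end LagrangianMap

/-! ### The maximum principle with a quadratic barrier. -/

section Comparison

open Filter Topology Metric Set
open scoped RealInnerProductSpace

variable {E : Type*} [NormedAddCommGroup E] [InnerProductSpace ℝ E]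

theorem ContDiff.hasDerivAt_curve {F G : Type*} [NormedAddCommGroup F] [NormedSpace ℝ F]
    [NormedAddCommGroup G] [NormedSpace ℝ G] {Φ : F → G} (hΦ : ContDiff ℝ ∞ Φ) {z : ℝ → F}
    {z' : F} {t : ℝ} (hz : HasDerivAt z z' t) :
    HasDerivAt (fun t => Φ (z t)) (fderiv ℝ Φ (z t) z') t :=
  (hΦ.hasFDerivAt_of_infty (z t)).comp_hasDerivAt t hz

theorem ContDiff.hasDerivAt_fderiv_curve {F G : Type*} [NormedAddCommGroup F] [NormedSpace ℝ F]
    [NormedAddCommGroup G] [NormedSpace ℝ G] {Φ : F → G} (hΦ : ContDiff ℝ ∞ Φ) {z z' : ℝ → F}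
    {z'' : F} {t : ℝ} (hz : HasDerivAt z (z' t) t) (hz' : HasDerivAt z' z'' t) :
    HasDerivAt (fun t => fderiv ℝ Φ (z t) (z' t))
      (fderiv ℝ (fderiv ℝ Φ) (z t) (z' t) (z' t) + fderiv ℝ Φ (z t) z'') t :=
  ((hΦ.hasFDerivAt_fderiv (z t)).comp_hasDerivAt t hz).clm_apply hz'

namespace IsLagrangianMap

variable {n : ℕ} {Ω Ω' : Set E} {f : E → E} {c : ℝ}

/-- Some eigenvalue of `D f` is somewhere bounded, by the mean value theorem. -/
theorem exists_eigenvalue_lt (hf : IsLagrangianMap n Ω Ω' f c) {p v : E}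
    (hp : p ∈ interior Ω) (hq : p + v ∈ interior Ω) (hv : v ≠ 0) {D : ℝ}
    (hD : ∀ a ∈ Ω', ∀ b ∈ Ω', ‖a - b‖ ≤ D) :
    ∃ l : Fin n → ℝ, (∀ k, 0 < l k) ∧ ∑ k, Real.arctan (l k) = c ∧ ∃ k, l k < D / ‖v‖ + 1 := by
  have hv0 : 0 < ‖v‖ := norm_pos_iff.2 hv
  have hseg : ∀ t ∈ Icc (0 : ℝ) 1, p + t • v ∈ interior Ω := fun t ht => by
    have := hf.convex.interior.add_smul_sub_mem hp hq ht
    simpa using this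
  have hd : ∀ t ∈ Icc (0 : ℝ) 1, HasDerivAt (fun t : ℝ => ⟪f (p + t • v), v⟫)
      ⟪fderivWithin ℝ f Ω (p + t • v) v, v⟫ t := by
    intro t ht
    have h1 : HasFDerivAt f (fderivWithin ℝ f Ω (p + t • v)) (p + t • v) :=
      (hf.hasFDerivWithinAt (interior_subset (hseg t ht))).hasFDerivAt
        (mem_interior_iff_mem_nhds.1 (hseg t ht))
    have h2 : HasDerivAt (fun t : ℝ => p + t • v) v t := by
      simpa using ((hasDerivAt_id t).smul_const v).const_add p
    have := (h1.comp_hasDerivAt t h2).inner ℝ (hasDerivAt_const t v)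
    simpa using this
  obtain ⟨t, ht, hslope⟩ := exists_hasDerivAt_eq_slope (fun t : ℝ => ⟪f (p + t • v), v⟫)
    (fun t => ⟪fderivWithin ℝ f Ω (p + t • v) v, v⟫) one_pos
    (fun t ht => (hd t ht).continuousAt.continuousWithinAt)
    (fun t ht => hd t (Ioo_subset_Icc_self ht))
  have htΩ := interior_subset (hseg t (Ioo_subset_Icc_self ht))
  obtain ⟨e, l, hl, he, hc⟩ := hf.eigen _ htΩ
  refine ⟨l, hl, hc, ?_⟩
  by_contra! hge
  have h1 : (D / ‖v‖ + 1) * ‖v‖ ^ 2 ≤ ⟪fderivWithin ℝ f Ω (p + t • v) v, v⟫ := by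
    rw [e.inner_map_eq_sum he, ← e.sum_inner_sq, Finset.mul_sum]
    exact Finset.sum_le_sum fun k _ => by
      rw [sq]; exact mul_le_mul_of_nonneg_right (hge k) (mul_self_nonneg _)
  have h2 : ⟪f (p + v) - f p, v⟫ ≤ D * ‖v‖ :=
    (real_inner_le_norm _ _).trans (mul_le_mul_of_nonneg_right
      (hD _ (hf.mapsTo (interior_subset hq)) _ (hf.mapsTo (interior_subset hp))) hv0.le)
  rw [inner_sub_left] at h2
  simp only [one_smul, zero_smul, add_zero, sub_zero, div_one] at hslope
  rw [hslope] at h1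
  have h3 : (D / ‖v‖ + 1) * ‖v‖ ^ 2 = D * ‖v‖ + ‖v‖ ^ 2 := by
    field_simp
  have : 0 < ‖v‖ ^ 2 := by positivity
  linarith

/-- The trace of the linearized operator is bounded below, uniformly over all Lagrangian maps
between two given domains. -/
theorem exists_pos_le_sum [Nontrivial E] (n : ℕ) (hint : (interior Ω).Nonempty)
    (hcpt' : IsCompact Ω') :
    ∃ ε : ℝ, 0 < ε ∧ ∀ (f : E → E) (c : ℝ), IsLagrangianMap n Ω Ω' f c → ∀ l : Fin n → ℝ,
      (∀ k, 0 < l k) → ∑ k, Real.arctan (l k) = c → ε ≤ ∑ k, 1 / (1 + l k ^ 2) := by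
  obtain ⟨p, hp⟩ := hint
  obtain ⟨r, hr, hball⟩ := Metric.isOpen_iff.1 isOpen_interior p hp
  obtain ⟨v, hv⟩ := exists_norm_eq E (half_pos hr).le
  have hv0 : v ≠ 0 := norm_pos_iff.1 (by rw [hv]; exact half_pos hr)
  have hq : p + v ∈ interior Ω := hball (by
    rw [mem_ball, dist_eq_norm, add_sub_cancel_left, hv]
    exact half_lt_self hr)
  obtain ⟨D, hD⟩ := Metric.isBounded_iff.1 hcpt'.isBounded
  set R := D / ‖v‖ + 1
  set η := Real.pi / 2 - Real.arctan R
  have hη : 0 < η := sub_pos.2 (Real.arctan_lt_pi_div_two R)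
  refine ⟨1 / (1 + (n / η) ^ 2), by positivity, fun f c hf l hl hlc => ?_⟩
  obtain ⟨m, hm, hmc, j, hj⟩ := hf.exists_eigenvalue_lt hp hq hv0
    (fun a ha b hb => by rw [← dist_eq_norm]; exact hD ha hb)
  -- The sum equals `nπ/2 - c`, so a bounded eigenvalue at one point bounds it below at every point.
  have h1 : η ≤ ∑ k, (Real.pi / 2 - Real.arctan (l k)) := by
    have e1 : ∑ k, (Real.pi / 2 - Real.arctan (l k)) =
        ∑ k, (Real.pi / 2 - Real.arctan (m k)) := by
      rw [Finset.sum_sub_distrib, Finset.sum_sub_distrib, hlc, hmc]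
    rw [e1]
    calc η ≤ Real.pi / 2 - Real.arctan (m j) :=
          sub_le_sub_left (Real.arctan_strictMono.monotone hj.le) _
      _ ≤ _ := Finset.single_le_sum (f := fun k => Real.pi / 2 - Real.arctan (m k))
          (fun k _ => (sub_pos.2 (Real.arctan_lt_pi_div_two _)).le) (Finset.mem_univ j)
  have hn : 0 < n := Fin.pos j
  have hn' : (0 : ℝ) < n := by exact_mod_cast hn
  -- Pigeonhole: some term `π/2 - arctan (l k) = arctan (1 / l k)` is at least `η / n`, and `arctan
  -- t ≤ t`.
  obtain ⟨k, hk⟩ : ∃ k, η / n ≤ (l k)⁻¹ := by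
    by_contra! hlt
    have h2 : ∑ k, (Real.pi / 2 - Real.arctan (l k)) < ∑ _k : Fin n, η / n := by
      refine Finset.sum_lt_sum_of_nonempty ⟨j, Finset.mem_univ j⟩ fun k _ => ?_
      rw [← Real.arctan_inv_of_pos (hl k)]
      exact (Real.arctan_le_self (inv_pos.2 (hl k)).le).trans_lt (hlt k)
    rw [Finset.sum_const, Finset.card_univ, Fintype.card_fin, nsmul_eq_mul,
      mul_div_cancel₀ _ hn'.ne'] at h2
    linarith
  have h3 : l k ≤ n / η := by
    rw [le_inv_comm₀ (by positivity) (hl k), inv_div] at hk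
    exact hk
  calc 1 / (1 + (n / η) ^ 2) ≤ 1 / (1 + l k ^ 2) := by
        have := hl k
        gcongr
    _ ≤ _ := Finset.single_le_sum (f := fun k => 1 / (1 + l k ^ 2))
          (fun k _ => by positivity) (Finset.mem_univ k)

/-- For an eigenvalue `a` this is the direction in which `(w, y, f y)` moves along `v`; the bound is
exactly what the weight `1 / (1 + a²)` cancels. The product carries the maximum norm. -/
theorem norm_sq_eigenvector_le {v : E} (hv : ‖v‖ = 1) (a : ℝ) :
    ‖((0 : E), v, a • v)‖ ^ 2 ≤ 1 + a ^ 2 := by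
  rw [Prod.norm_def, Prod.norm_def]
  simp only [norm_zero, norm_smul, hv, mul_one, Real.norm_eq_abs]
  rcases max_cases (1 : ℝ) |a| with ⟨h, -⟩ | ⟨h, -⟩ <;> rw [h]
  · rw [max_eq_right zero_le_one]; nlinarith [sq_nonneg a]
  · rw [max_eq_right (abs_nonneg a), sq_abs]; linarith

/-- Comparison with a quadratic barrier for functions of `(y, f(y))`, plus a nonnegative multiple
of a second derivative of the potential. -/
theorem comparison (hf : IsLagrangianMap n Ω Ω' f c) {x₀ ν₀ : E} {κ ε K s m C : ℝ}
    (hb : ∀ y ∈ Ω, ⟪ν₀, y - x₀⟫ + κ * ‖y - x₀‖ ^ 2 ≤ 0)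
    (hε : ∀ l : Fin n → ℝ, (∀ k, 0 < l k) → ∑ k, Real.arctan (l k) = c →
      ε ≤ ∑ k, 1 / (1 + l k ^ 2))
    {Φ : E × E × E → ℝ} (hΦ : ContDiff ℝ ∞ Φ) {w : E} (hK0 : 0 ≤ K)
    (hK : ∀ x ∈ Ω, ∀ p ∈ Ω', ∀ z, -(K * ‖z‖ ^ 2) ≤ fderiv ℝ (fderiv ℝ Φ) (w, x, p) z z)
    (hs : 0 ≤ s) (hC0 : 0 ≤ C) (hκ : 0 ≤ κ) (hC : n * K < 2 * C * κ * ε)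
    (hbd : ∀ y ∈ frontier Ω, s * ⟪fderivWithin ℝ f Ω y w, w⟫ + Φ (w, y, f y) ≤ m) :
    ∀ y ∈ Ω, s * ⟪fderivWithin ℝ f Ω y w, w⟫ + Φ (w, y, f y) +
      C * (⟪ν₀, y - x₀⟫ + κ * ‖y - x₀‖ ^ 2) ≤ m := by
  set A := fderivWithin ℝ f Ω with hA
  set ψ : E → ℝ := fun y => s * ⟪A y w, w⟫ + Φ (w, y, f y) +
    C * (⟪ν₀, y - x₀⟫ + κ * ‖y - x₀‖ ^ 2) with hψ
  have hcont : ContinuousOn ψ Ω := by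
    have h1 : ContinuousOn (fun y => A y w) Ω :=
      hf.contDiffOn_fderivWithin.continuousOn.clm_apply continuousOn_const
    have h2 : ContinuousOn (fun y => Φ (w, y, f y)) Ω :=
      hΦ.continuous.comp_continuousOn
        (continuousOn_const.prodMk (continuousOn_id.prodMk hf.contDiffOn.continuousOn))
    have h3 : Continuous fun y => C * (⟪ν₀, y - x₀⟫ + κ * ‖y - x₀‖ ^ 2) := by fun_prop
    exact ((continuousOn_const.mul (h1.inner continuousOn_const)).add h2).add h3.continuousOn
  obtain ⟨x, hx, hmax⟩ := hf.isCompact.exists_isMaxOn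
    (hf.nonempty_interior.mono interior_subset) hcont
  intro y hy
  refine (hmax hy).trans ?_
  by_cases hxi : x ∈ interior Ω
  swap
  · have hxf : x ∈ frontier Ω := ⟨subset_closure hx, hxi⟩
    have := mul_nonpos_of_nonneg_of_nonpos hC0 (hb x hx)
    simp only [hψ]
    linarith [hbd x hxf]
  -- At an interior maximum all pure second derivatives are nonpositive, but their weighted sum is
  -- at least `-nK + 2Cκε > 0`.
  exfalso
  obtain ⟨e, l, hl, he, hc⟩ := hf.eigen x hx
  set B := fderivWithin ℝ A Ω with hB
  set T := fderivWithin ℝ B Ω with hT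
  have key : ∀ k, s * ⟪T x (e k) (e k) w, w⟫ + (fderiv ℝ (fderiv ℝ Φ) (w, x, f x)
      (0, e k, l k • e k) (0, e k, l k • e k) + fderiv ℝ Φ (w, x, f x) (0, 0, B x (e k) (e k))) +
      2 * C * κ ≤ 0 := by
    intro k
    set v := e k
    have hv1 : ‖v‖ = 1 := e.norm_eq_one k
    have d1 := eventually_hasDerivAt_line (fun y hy => hf.hasFDerivWithinAt hy) hxi v
    have d2 := eventually_hasDerivAt_line (fun y hy => hf.hasFDerivWithinAt₂ hy) hxi v
    have d3 := eventually_hasDerivAt_line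
      (φ' := fderivWithin ℝ (fderivWithin ℝ (fderivWithin ℝ f Ω) Ω) Ω)
      (fun y hy => hf.hasFDerivWithinAt₃ hy) hxi v
    have dl : ∀ t : ℝ, HasDerivAt (fun t : ℝ => x + t • v) v t := fun t => by
      simpa using ((hasDerivAt_id t).smul_const v).const_add x
    have hloc : IsLocalMax (fun t : ℝ => ψ (x + t • v)) 0 := by
      have hc : Tendsto (fun t : ℝ => x + t • v) (𝓝 0) (𝓝 x) := by
        have : Continuous fun t : ℝ => x + t • v := by fun_prop
        simpa using this.tendsto 0
      filter_upwards [hc.eventually (isOpen_interior.mem_nhds hxi)] with t ht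
      simpa using hmax (interior_subset ht)
    refine hloc.second_deriv_nonpos (φ' := fun t : ℝ => s * ⟪B (x + t • v) v w, w⟫ +
      fderiv ℝ Φ (w, x + t • v, f (x + t • v)) (0, v, A (x + t • v) v) +
      C * (⟪ν₀, v⟫ + κ * (2 * ⟪x + t • v - x₀, v⟫))) ?_ ?_
    · filter_upwards [d1, d2] with t h1 h2
      have g1 := ((h2.clm_apply (hasDerivAt_const t w)).inner ℝ (hasDerivAt_const t w)).const_mul s
      have g2 := hΦ.hasDerivAt_curve ((hasDerivAt_const t w).prodMk ((dl t).prodMk h1))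
      have g3 := (((hasDerivAt_const t ν₀).inner ℝ ((dl t).sub_const x₀)).fun_add
        ((((dl t).sub_const x₀).norm_sq).const_mul κ)).const_mul C
      have := (g1.fun_add g2).fun_add g3
      simpa using this
    · have g1 := ((((d3.self_of_nhds).clm_apply (hasDerivAt_const (0 : ℝ) v)).clm_apply
        (hasDerivAt_const (0 : ℝ) w)).inner ℝ (hasDerivAt_const (0 : ℝ) w)).const_mul s
      have g2 := hΦ.hasDerivAt_fderiv_curve
        (z := fun t => (w, x + t • v, f (x + t • v)))
        (z' := fun t => ((0 : E), v, A (x + t • v) v)) (t := 0)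
        ((hasDerivAt_const (0 : ℝ) w).prodMk ((dl 0).prodMk d1.self_of_nhds))
        ((hasDerivAt_const (0 : ℝ) (0 : E)).prodMk ((hasDerivAt_const (0 : ℝ) v).prodMk
          (d2.self_of_nhds.clm_apply (hasDerivAt_const (0 : ℝ) v))))
      have g3 := (((((dl 0).sub_const x₀).inner ℝ (hasDerivAt_const (0 : ℝ) v)).const_mul
        2).const_mul κ).const_add ⟪ν₀, v⟫ |>.const_mul C
      refine ((g1.fun_add g2).fun_add g3).congr_deriv ?_
      simp [hv1, hT, hB, hA, he, v]
      ring
  have hsum : ∑ k, 1 / (1 + l k ^ 2) * (s * ⟪T x (e k) (e k) w, w⟫ +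
      (fderiv ℝ (fderiv ℝ Φ) (w, x, f x) (0, e k, l k • e k) (0, e k, l k • e k) +
        fderiv ℝ Φ (w, x, f x) (0, 0, B x (e k) (e k))) + 2 * C * κ) ≤ 0 :=
    Finset.sum_nonpos fun k _ => mul_nonpos_of_nonneg_of_nonpos (by positivity) (key k)
  have e1 := hf.sum_third_nonneg hxi hl he hc w
  have e2 := hf.sum_smul_second_eq_zero hxi hl he hc
  have e3 : ∑ k, 1 / (1 + l k ^ 2) * fderiv ℝ Φ (w, x, f x) (0, 0, B x (e k) (e k)) = 0 := by
    have : ∀ k, 1 / (1 + l k ^ 2) * fderiv ℝ Φ (w, x, f x) (0, 0, B x (e k) (e k)) =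
        ((fderiv ℝ Φ (w, x, f x)).comp ((ContinuousLinearMap.inr ℝ E (E × E)).comp
          (ContinuousLinearMap.inr ℝ E E))) ((1 / (1 + l k ^ 2)) • B x (e k) (e k)) := fun k => by
      rw [map_smul]; simp
    simp_rw [this]
    rw [← map_sum, e2, map_zero]
  have e4 : -(n * K) ≤ ∑ k, 1 / (1 + l k ^ 2) *
      fderiv ℝ (fderiv ℝ Φ) (w, x, f x) (0, e k, l k • e k) (0, e k, l k • e k) := by
    calc -(n * K) = ∑ _k : Fin n, -K := by simp
      _ ≤ _ := Finset.sum_le_sum fun k _ => by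
        have h1 := hK x hx (f x) (hf.mapsTo hx) (0, e k, l k • e k)
        have h2 := norm_sq_eigenvector_le (e.norm_eq_one k) (l k)
        have h3 : 0 < 1 + l k ^ 2 := by positivity
        rw [one_div, ← div_eq_inv_mul, le_div_iff₀ h3]
        nlinarith
  have e5 := hε l hl hc
  have e6 : ∑ k, 1 / (1 + l k ^ 2) * (s * ⟪T x (e k) (e k) w, w⟫ +
      (fderiv ℝ (fderiv ℝ Φ) (w, x, f x) (0, e k, l k • e k) (0, e k, l k • e k) +
        fderiv ℝ Φ (w, x, f x) (0, 0, B x (e k) (e k))) + 2 * C * κ) =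
      s * ∑ k, 1 / (1 + l k ^ 2) * ⟪T x (e k) (e k) w, w⟫ +
      (∑ k, 1 / (1 + l k ^ 2) *
        fderiv ℝ (fderiv ℝ Φ) (w, x, f x) (0, e k, l k • e k) (0, e k, l k • e k) +
      ∑ k, 1 / (1 + l k ^ 2) * fderiv ℝ Φ (w, x, f x) (0, 0, B x (e k) (e k))) +
      (2 * C * κ) * ∑ k, 1 / (1 + l k ^ 2) := by
    rw [Finset.mul_sum, Finset.mul_sum, ← Finset.sum_add_distrib, ← Finset.sum_add_distrib,
      ← Finset.sum_add_distrib]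
    exact Finset.sum_congr rfl fun k _ => by ring
  rw [e6, e3] at hsum
  have e7 : 0 ≤ s * ∑ k, 1 / (1 + l k ^ 2) * ⟪T x (e k) (e k) w, w⟫ := mul_nonneg hs e1
  have e8 : 2 * C * κ * ε ≤ 2 * C * κ * ∑ k, 1 / (1 + l k ^ 2) :=
    mul_le_mul_of_nonneg_left e5 (by positivity)
  linarith

theorem mem_of_mem_frontier (hf : IsLagrangianMap n Ω Ω' f c) {x : E} (hx : x ∈ frontier Ω) :
    x ∈ Ω :=
  hf.isCompact.isClosed.frontier_subset hx

/-- Decomposition of the Hessian along the target normal and the tangent space. -/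
theorem inner_fderivWithin_self_eq (hf : IsLagrangianMap n Ω Ω' f c) {x : E} (hx : x ∈ Ω)
    {ν ν' : E} {τ : ℝ} (hA : fderivWithin ℝ f Ω x ν' = τ • ν) (hχ : 0 < ⟪ν, ν'⟫) (w : E) :
    ⟪ν, w - (⟪ν, w⟫ / ⟪ν, ν'⟫) • ν'⟫ = 0 ∧
    ⟪fderivWithin ℝ f Ω x w, w⟫ =
      ⟪fderivWithin ℝ f Ω x (w - (⟪ν, w⟫ / ⟪ν, ν'⟫) • ν'), w - (⟪ν, w⟫ / ⟪ν, ν'⟫) • ν'⟫ +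
        ⟪ν, w⟫ ^ 2 * (τ / ⟪ν, ν'⟫) := by
  constructor
  · rw [inner_sub_right, real_inner_smul_right, div_mul_cancel₀ _ hχ.ne', sub_self]
  · have h1 : ⟪fderivWithin ℝ f Ω x w, ν'⟫ = τ * ⟪ν, w⟫ := by
      rw [hf.inner_fderivWithin_comm hx, hA, real_inner_smul_left]
    simp only [map_sub, map_smul, inner_sub_left, inner_sub_right, real_inner_smul_left,
      real_inner_smul_right, hA, h1]
    field_simp
    ring

end IsLagrangianMap

end Comparison

/-! ### One-sided bounds for normal derivatives at boundary maxima. -/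

section BoundaryEstimate

open Filter Topology Metric Set
open scoped RealInnerProductSpace

theorem ContDiff.exists_abs_fderiv_fderiv_le {F : Type*} [NormedAddCommGroup F] [NormedSpace ℝ F]
    {Φ : F → ℝ} (hΦ : ContDiff ℝ ∞ Φ) {S : Set F} (hS : IsCompact S) :
    ∃ K : ℝ, 0 < K ∧ ∀ z ∈ S, ∀ v, |fderiv ℝ (fderiv ℝ Φ) z v v| ≤ K * ‖v‖ ^ 2 := by
  obtain ⟨K, hK, HK⟩ := hS.exists_pos_forall_ge (f := fun z => ‖fderiv ℝ (fderiv ℝ Φ) z‖)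
    (Continuous.norm (E := F →L[ℝ] F →L[ℝ] ℝ) hΦ.continuous_fderiv_fderiv).continuousOn
  refine ⟨K, hK, fun z hz v => ?_⟩
  refine (ContinuousLinearMap.le_opNorm₂ (fderiv ℝ (fderiv ℝ Φ) z) v v).trans ?_
  rw [mul_assoc, ← sq]
  exact mul_le_mul_of_nonneg_right (HK z hz) (by positivity)

theorem IsCompact.isCompact_frontier {X : Type*} [TopologicalSpace X] [T2Space X] {Ω : Set X}
    (hcpt : IsCompact Ω) : IsCompact (frontier Ω) :=
  hcpt.of_isClosed_subset isClosed_frontier hcpt.isClosed.frontier_subset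

/-- A linear functional which is nonpositive on an open half-space is a nonnegative multiple of
the functional defining it. -/
theorem exists_eq_mul_inner_of_halfSpace {E : Type*} [NormedAddCommGroup E]
    [InnerProductSpace ℝ E] {ν : E} (hν : ν ≠ 0) {L : E →L[ℝ] ℝ}
    (hL : ∀ v, ⟪ν, v⟫ < 0 → L v ≤ 0) : ∃ μ : ℝ, 0 ≤ μ ∧ ∀ v, L v = μ * ⟪ν, v⟫ := by
  have hpos : 0 < ⟪ν, ν⟫ := real_inner_self_pos.2 hν
  have hLν : 0 ≤ L ν := by
    have := hL (-ν) (by rw [inner_neg_right]; linarith)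
    rw [map_neg] at this
    linarith
  have hle : ∀ v, ⟪ν, v⟫ = 0 → L v ≤ 0 := by
    intro v hv
    refine le_of_forall_pos_le_add fun δ hδ => ?_
    have h1 : 0 < δ / (L ν + 1) := by positivity
    have := hL (v - (δ / (L ν + 1)) • ν) (by
      rw [inner_sub_right, real_inner_smul_right, hv]
      nlinarith [mul_pos h1 hpos])
    rw [map_sub, map_smul, smul_eq_mul] at this
    have h2 : δ / (L ν + 1) * L ν ≤ δ := by
      rw [div_mul_eq_mul_div, div_le_iff₀ (by positivity)]
      nlinarith
    linarith
  refine ⟨L ν / ⟪ν, ν⟫, by positivity, fun v => ?_⟩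
  have h0 : ⟪ν, v - (⟪ν, v⟫ / ⟪ν, ν⟫) • ν⟫ = 0 := by
    rw [inner_sub_right, real_inner_smul_right, div_mul_cancel₀ _ hpos.ne', sub_self]
  have h1 := hle _ h0
  have h2 := hle (-(v - (⟪ν, v⟫ / ⟪ν, ν⟫) • ν)) (by rw [inner_neg_right, h0, neg_zero])
  rw [map_neg] at h2
  have h3 : L (v - (⟪ν, v⟫ / ⟪ν, ν⟫) • ν) = 0 := le_antisymm h1 (by linarith)
  rw [map_sub, map_smul, sub_eq_zero, smul_eq_mul] at h3
  rw [h3]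
  ring

variable {E : Type*} [NormedAddCommGroup E] [InnerProductSpace ℝ E] [FiniteDimensional ℝ E]

theorem ContDiff.gradient_of_infty {h : E → ℝ} (hh : ContDiff ℝ ∞ h) :
    ContDiff ℝ ∞ (gradient h) :=
  (InnerProductSpace.toDual ℝ E).symm.contDiff.comp (hh.fderiv_right (m := ∞) (by simp))

theorem ContDiff.inner_fderiv_gradient {h : E → ℝ} (hh : ContDiff ℝ ∞ h) (x v w : E) :
    ⟪fderiv ℝ (gradient h) x v, w⟫ = fderiv ℝ (fderiv ℝ h) x v w := by
  have h1 := (hh.gradient_of_infty.hasFDerivAt_of_infty x).inner ℝ (hasFDerivAt_const w x)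
  have h2 := (hh.hasFDerivAt_fderiv x).clm_apply (hasFDerivAt_const w x)
  have e : (fun y => ⟪gradient h y, w⟫) = fun y => fderiv ℝ h y w :=
    funext fun y => inner_gradient_left
  rw [e] at h1
  have := congrArg (fun L : E →L[ℝ] ℝ => L v) (h1.unique h2)
  simpa using this

/-- A negative derivative makes `h (x + t v)` negative for small `t > 0`, so the ray enters `Ω`. -/
theorem IsBoundaryDefining.mem_posTangentConeAt {Ω : Set E} {h : E → ℝ}
    (hh : IsBoundaryDefining Ω h) {x : E} (hx : x ∈ frontier Ω) {v : E}
    (hv : ⟪gradient h x, v⟫ < 0) : v ∈ posTangentConeAt Ω x := by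
  have hl : HasDerivAt (fun t : ℝ => x + t • v) v 0 := by
    simpa using ((hasDerivAt_id (0 : ℝ)).smul_const v).const_add x
  have hd := hh.contDiff.hasDerivAt_curve hl
  have hs := hd.tendsto_slope_zero_right
  simp only [zero_smul, add_zero, zero_add, hh.eq_zero x hx, sub_zero] at hs
  rw [← inner_gradient_left] at hs
  have h1 := hs.eventually_lt_const hv
  have hc : Tendsto (fun t : ℝ => x + t • v) (𝓝 0) (𝓝 x) := by
    simpa using hl.continuousAt.tendsto
  have h2 := (hc.eventually (hh.eventually_mem x hx)).filter_mono
    (nhdsWithin_le_nhds (s := Ioi 0))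
  refine mem_posTangentConeAt_of_frequently_mem (Eventually.frequently ?_)
  filter_upwards [h1, h2, self_mem_nhdsWithin] with t ht1 ht2 ht0
  refine ht2 ?_
  have ht0' : (0 : ℝ) < t := ht0
  rw [smul_eq_mul, inv_mul_lt_iff₀ ht0', mul_zero] at ht1
  exact ht1.le

/-- The derivative at a boundary maximum is a nonnegative multiple of the outer normal. -/
theorem IsStrictBoundaryDefining.exists_eq_mul_inner_of_isMaxOn {Ω : Set E} {h : E → ℝ}
    (hh : IsStrictBoundaryDefining Ω h) {x : E} (hx : x ∈ frontier Ω) {φ : E → ℝ}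
    {L : E →L[ℝ] ℝ} (hφ : HasFDerivWithinAt φ L Ω x) (hmax : IsMaxOn φ Ω x) :
    ∃ μ : ℝ, 0 ≤ μ ∧ ∀ v, L v = μ * ⟪gradient h x, v⟫ :=
  exists_eq_mul_inner_of_halfSpace (hh.gradient_ne_zero x hx) fun _ hv =>
    hmax.localize.hasFDerivWithinAt_nonpos hφ (hh.mem_posTangentConeAt hx hv)

/-- A comparison function that attains its boundary maximum at `x₀` has normal derivative at
least `-C` there, with `C` independent of the Lagrangian map. -/
theorem IsLagrangianMap.exists_boundary_estimate [Nontrivial E] (n : ℕ) {Ω Ω' : Set E}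
    (hcpt : IsCompact Ω) (hint : (interior Ω).Nonempty) (hcpt' : IsCompact Ω') {h : E → ℝ}
    (hh : IsStrictBoundaryDefining Ω h) {Φ : E × E × E → ℝ} (hΦ : ContDiff ℝ ∞ Φ) :
    ∃ C : ℝ, 0 < C ∧ ∀ (f : E → E) (c : ℝ), IsLagrangianMap n Ω Ω' f c →
      ∀ (s m : ℝ) (w : E), 0 ≤ s → ‖w‖ ≤ 1 →
      (∀ y ∈ frontier Ω, s * ⟪fderivWithin ℝ f Ω y w, w⟫ + Φ (w, y, f y) ≤ m) →
      ∀ x₀ ∈ frontier Ω,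
        (∀ y ∈ Ω, s * ⟪fderivWithin ℝ f Ω y w, w⟫ + Φ (w, y, f y) ≤ m + C) ∧
        (s * ⟪fderivWithin ℝ f Ω x₀ w, w⟫ + Φ (w, x₀, f x₀) = m →
          ∃ μ : ℝ, -C ≤ μ ∧ ∀ v,
            s * ⟪fderivWithin ℝ (fderivWithin ℝ f Ω) Ω x₀ v w, w⟫ +
              fderiv ℝ Φ (w, x₀, f x₀) (0, v, fderivWithin ℝ f Ω x₀ v) =
                μ * ⟪gradient h x₀, v⟫) := by
  obtain ⟨ε, hε, Hε⟩ := exists_pos_le_sum n hint hcpt'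
  obtain ⟨κ, hκ, Hκ⟩ := hh.support
  have hfc : IsCompact (frontier Ω) := hcpt.isCompact_frontier
  obtain ⟨K, hK, HK⟩ := hΦ.exists_abs_fderiv_fderiv_le ((isCompact_closedBall (0 : E) 1).prod
    (hcpt.prod hcpt'))
  obtain ⟨D, hD, HD⟩ := (hfc.prod hcpt).exists_pos_forall_ge
    (f := fun z => -⟪gradient h z.1, z.2 - z.1⟫)
    ((hh.contDiff.gradient_of_infty.continuous.comp continuous_fst).inner
      (continuous_snd.sub continuous_fst)).neg.continuousOn
  -- Chosen so that `2 C₀ κ ε = n K + 1` exceeds the error `n K` in `comparison`.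
  set C₀ := (n * K + 1) / (2 * κ * ε)
  have hC₀ : 0 < C₀ := by positivity
  have hC₀' : n * K < 2 * C₀ * κ * ε := by
    have : 2 * C₀ * κ * ε = n * K + 1 := by
      simp only [C₀]; field_simp
    rw [this]; linarith
  refine ⟨C₀ * (1 + D), by positivity, fun f c hf s m w hs hw hbd x₀ hx₀ => ?_⟩
  have hx₀Ω := hcpt.isClosed.frontier_subset hx₀
  have hb : ∀ y ∈ Ω, ⟪gradient h x₀, y - x₀⟫ + κ * ‖y - x₀‖ ^ 2 ≤ 0 := fun y hy => by
    have := Hκ x₀ hx₀ y hy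
    rw [← inner_gradient_left] at this
    linarith
  have hcomp := hf.comparison hb (Hε f c hf) hΦ (w := w) hK.le (fun x hx p hp z => by
      exact (abs_le.1 (HK (w, x, p) ⟨by simpa using hw, hx, hp⟩ z)).1) hs hC₀.le hκ.le hC₀' hbd
  constructor
  · intro y hy
    have h1 := hcomp y hy
    have h2 := HD (x₀, y) ⟨hx₀, hy⟩
    have h3 : -D ≤ ⟪gradient h x₀, y - x₀⟫ + κ * ‖y - x₀‖ ^ 2 := by
      have : 0 ≤ κ * ‖y - x₀‖ ^ 2 := by positivity
      simp only at h2
      linarith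
    nlinarith
  · intro heq
    have hA := (hf.hasFDerivWithinAt₂ hx₀Ω)
    have g1 := ((hA.clm_apply (hasFDerivWithinAt_const w x₀ Ω)).inner ℝ
      (hasFDerivWithinAt_const w x₀ Ω)).const_mul s
    have g2 := (hΦ.hasFDerivAt_of_infty (w, x₀, f x₀)).comp_hasFDerivWithinAt x₀
      ((hasFDerivWithinAt_const w x₀ Ω).prodMk
        ((hasFDerivWithinAt_id x₀ Ω).prodMk (hf.hasFDerivWithinAt hx₀Ω)))
    have g0 := (hasFDerivWithinAt_id (𝕜 := ℝ) x₀ Ω).sub_const x₀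
    have g3 := (((hasFDerivWithinAt_const (gradient h x₀) x₀ Ω).inner ℝ g0).fun_add
      (g0.norm_sq.const_mul κ)).const_mul C₀
    obtain ⟨μ, hμ, H⟩ := hh.exists_eq_mul_inner_of_isMaxOn hx₀ ((g1.fun_add g2).fun_add g3)
      (fun y hy => by
        have := hcomp y hy
        simpa [heq] using this)
    -- The barrier has gradient `∇h(x₀)` at `x₀`, so removing it lowers the multiplier by `C₀`.
    refine ⟨μ - C₀, ?_, fun v => ?_⟩
    · have : 0 ≤ C₀ * D := by positivity
      linarith
    · have := H v
      simp at this
      rw [inner_gradient_left]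
      linarith

end BoundaryEstimate

/-! ### Normal derivative bound, uniform obliqueness and the parabola condition. -/

section HessianBound

open Filter Topology Metric Set
open scoped RealInnerProductSpace

variable {E : Type*} [NormedAddCommGroup E] [InnerProductSpace ℝ E] [FiniteDimensional ℝ E]

namespace IsLagrangianMap

variable {n : ℕ} {Ω Ω' : Set E} {f : E → E} {c : ℝ} {h h' : E → ℝ}

/-- `D f` maps the target normal to a positive multiple of the domain normal. -/
theorem exists_fderivWithin_gradient_eq (hf : IsLagrangianMap n Ω Ω' f c)
    (hh : IsStrictBoundaryDefining Ω h) (hh' : IsStrictBoundaryDefining Ω' h') {x : E}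
    (hx : x ∈ frontier Ω) :
    ∃ τ : ℝ, 0 < τ ∧ fderivWithin ℝ f Ω x (gradient h' (f x)) = τ • gradient h x ∧
      0 < ⟪gradient h x, gradient h' (f x)⟫ := by
  have hxΩ := hf.mem_of_mem_frontier hx
  have hfx := hf.mapsTo_frontier hx
  obtain ⟨κ, hκ, Hκ⟩ := hh'.support
  set ν' := gradient h' (f x)
  -- The target lies in its tangent half-space at `f x`, so `⟨ν', f⟩` is maximal over `Ω` at `x`.
  -- Pairing the resulting identity with `ν'` then gives both signs by positivity of `Df`.
  have g := (hasFDerivWithinAt_const ν' x Ω).inner ℝ (hf.hasFDerivWithinAt hxΩ)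
  obtain ⟨τ, hτ, H⟩ := hh.exists_eq_mul_inner_of_isMaxOn hx g (fun y hy => by
    have h1 := Hκ (f x) hfx (f y) (hf.mapsTo hy)
    rw [← inner_gradient_left, inner_sub_right] at h1
    have h2 : 0 ≤ κ * ‖f y - f x‖ ^ 2 := by positivity
    simp only [Set.mem_ofPred_eq]
    linarith)
  have H' : ∀ v, ⟪ν', fderivWithin ℝ f Ω x v⟫ = τ * ⟪gradient h x, v⟫ := fun v => by
    have := H v
    simpa using this
  have hpos := hf.inner_fderivWithin_self_pos hxΩ (hh'.gradient_ne_zero (f x) hfx)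
  rw [real_inner_comm, H'] at hpos
  have hτ0 : 0 < τ := lt_of_le_of_ne hτ fun h0 => by
    rw [← h0, zero_mul] at hpos
    exact lt_irrefl _ hpos
  refine ⟨τ, hτ0, ?_, pos_of_mul_pos_right hpos hτ⟩
  refine ext_inner_right ℝ fun v => ?_
  rw [hf.inner_fderivWithin_comm hxΩ, real_inner_comm, H', real_inner_smul_left]

/-- Uniform bound for the normal derivative of `h' ∘ f`. -/
theorem exists_normal_bound [Nontrivial E] (n : ℕ) (hcpt : IsCompact Ω)
    (hint : (interior Ω).Nonempty) (hcpt' : IsCompact Ω')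
    (hh : IsStrictBoundaryDefining Ω h) (hh' : IsStrictBoundaryDefining Ω' h') :
    ∃ C : ℝ, 0 < C ∧ ∀ (f : E → E) (c : ℝ), IsLagrangianMap n Ω Ω' f c → ∀ x ∈ frontier Ω,
      ∃ τ : ℝ, 0 < τ ∧ τ ≤ C ∧
        fderivWithin ℝ f Ω x (gradient h' (f x)) = τ • gradient h x ∧
        0 < ⟪gradient h x, gradient h' (f x)⟫ := by
  have hΦ : ContDiff ℝ ∞ (fun z : E × E × E => -h' z.2.2) :=
    (hh'.contDiff.comp (contDiff_snd.comp contDiff_snd)).neg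
  obtain ⟨C, hC, H⟩ := exists_boundary_estimate n hcpt hint hcpt' hh hΦ
  refine ⟨C, hC, fun f c hf x hx => ?_⟩
  obtain ⟨τ, hτ, hA, hχ⟩ := hf.exists_fderivWithin_gradient_eq hh hh' hx
  refine ⟨τ, hτ, ?_, hA, hχ⟩
  -- Since `h' ∘ f` vanishes on the frontier, every frontier point is a maximum; the multiplier
  -- there is `-τ`.
  obtain ⟨μ, hμ, Hμ⟩ := (H f c hf 0 0 0 le_rfl (by simp)
    (fun y hy => by simp [hh'.eq_zero _ (hf.mapsTo_frontier hy)]) x hx).2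
    (by simp [hh'.eq_zero _ (hf.mapsTo_frontier hx)])
  have hd : fderiv ℝ (fun z : E × E × E => -h' z.2.2) (0, x, f x) =
      -(fderiv ℝ h' (f x)).comp
        ((ContinuousLinearMap.snd ℝ E E).comp (ContinuousLinearMap.snd ℝ E (E × E))) :=
    (((hh'.contDiff.hasFDerivAt_of_infty (f x)).comp (0, x, f x)
      ((ContinuousLinearMap.snd ℝ E E).comp
        (ContinuousLinearMap.snd ℝ E (E × E))).hasFDerivAt).neg).fderiv
  have h1 := Hμ (gradient h x)
  rw [hd] at h1
  simp only [zero_mul, zero_add, neg_apply, ContinuousLinearMap.comp_apply,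
    ContinuousLinearMap.coe_snd'] at h1
  rw [← inner_gradient_left, real_inner_comm,
    hf.inner_fderivWithin_comm (hf.mem_of_mem_frontier hx), hA, real_inner_smul_left] at h1
  have hpos : 0 < ⟪gradient h x, gradient h x⟫ :=
    real_inner_self_pos.2 (hh.gradient_ne_zero x hx)
  have h2 : (-τ) * ⟪gradient h x, gradient h x⟫ = μ * ⟪gradient h x, gradient h x⟫ := by
    linarith
  have := mul_right_cancel₀ hpos.ne' h2
  linarith

theorem exists_gradient_norm_bounds {Ω : Set E} {h : E → ℝ} (hcpt : IsCompact Ω)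
    (hh : IsStrictBoundaryDefining Ω h) :
    ∃ a b : ℝ, 0 < a ∧ 0 < b ∧ ∀ x ∈ frontier Ω, a ≤ ‖gradient h x‖ ∧ ‖gradient h x‖ ≤ b := by
  have hcont : ContinuousOn (fun x => ‖gradient h x‖) (frontier Ω) :=
    hh.contDiff.gradient_of_infty.continuous.norm.continuousOn
  obtain ⟨a, ha, Ha⟩ := hcpt.isCompact_frontier.exists_pos_forall_le hcont
    fun x hx => norm_pos_iff.2 (hh.gradient_ne_zero x hx)
  obtain ⟨b, hb, Hb⟩ := hcpt.isCompact_frontier.exists_pos_forall_ge hcont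
  exact ⟨a, b, ha, hb, fun x hx => ⟨Ha x hx, Hb x hx⟩⟩

theorem contDiff_inner_gradient (hh : ContDiff ℝ ∞ h) (hh' : ContDiff ℝ ∞ h') :
    ContDiff ℝ ∞ (fun z : E × E × E => ⟪gradient h z.2.1, gradient h' z.2.2⟫) :=
  (hh.gradient_of_infty.comp (contDiff_fst.comp contDiff_snd)).inner ℝ
    (hh'.gradient_of_infty.comp (contDiff_snd.comp contDiff_snd))

theorem fderiv_inner_gradient (hh : ContDiff ℝ ∞ h) (hh' : ContDiff ℝ ∞ h') (w x p u v : E) :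
    fderiv ℝ (fun z : E × E × E => -⟪gradient h z.2.1, gradient h' z.2.2⟫) (w, x, p) (0, u, v) =
      -(⟪gradient h x, fderiv ℝ (gradient h') p v⟫ +
        ⟪fderiv ℝ (gradient h) x u, gradient h' p⟫) := by
  have g1 := (hh.gradient_of_infty.hasFDerivAt_of_infty x).comp (w, x, p)
    ((ContinuousLinearMap.fst ℝ E E).comp (ContinuousLinearMap.snd ℝ E (E × E))).hasFDerivAt
  have g2 := (hh'.gradient_of_infty.hasFDerivAt_of_infty p).comp (w, x, p)
    ((ContinuousLinearMap.snd ℝ E E).comp (ContinuousLinearMap.snd ℝ E (E × E))).hasFDerivAt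
  have := (g1.inner ℝ g2).fun_neg.fderiv
  have := congrArg (fun L : E × E × E →L[ℝ] ℝ => L (0, u, v)) this
  simpa using this

/-- Uniform obliqueness. -/
theorem exists_oblique [Nontrivial E] (n : ℕ) (hcpt : IsCompact Ω)
    (hint : (interior Ω).Nonempty) (hcpt' : IsCompact Ω')
    (hh : IsStrictBoundaryDefining Ω h) (hh' : IsStrictBoundaryDefining Ω' h') :
    ∃ χ : ℝ, 0 < χ ∧ ∀ (f : E → E) (c : ℝ), IsLagrangianMap n Ω Ω' f c → ∀ x ∈ frontier Ω,
      χ ≤ ⟪gradient h x, gradient h' (f x)⟫ := by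
  obtain ⟨C, hC, H⟩ := exists_boundary_estimate n hcpt hint hcpt' hh
    (contDiff_inner_gradient hh.contDiff hh'.contDiff).neg
  obtain ⟨θ, hθ, Hθ⟩ := hh.hessian_pos
  obtain ⟨θ', hθ', Hθ'⟩ := hh'.hessian_pos
  obtain ⟨a, b, ha, -, Ha⟩ := exists_gradient_norm_bounds hcpt' hh'
  refine ⟨θ * a ^ 2 / C, by positivity, fun f c hf x hx => ?_⟩
  have hcont : ContinuousOn (fun y => ⟪gradient h y, gradient h' (f y)⟫) (frontier Ω) :=
    hh.contDiff.gradient_of_infty.continuous.continuousOn.inner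
      (hh'.contDiff.gradient_of_infty.continuous.comp_continuousOn
        (hf.contDiffOn.continuousOn.mono hcpt.isClosed.frontier_subset))
  obtain ⟨x₀, hx₀, hmin⟩ := hcpt.isCompact_frontier.exists_isMinOn ⟨x, hx⟩ hcont
  refine le_trans ?_ (hmin hx)
  obtain ⟨τ, hτ, hA, hχ⟩ := hf.exists_fderivWithin_gradient_eq hh hh' hx₀
  set ν := gradient h x₀
  set ν' := gradient h' (f x₀) with hν'
  obtain ⟨μ, hμ, Hμ⟩ := (H f c hf 0 (-⟪ν, ν'⟫) 0 le_rfl (by simp)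
    (fun y hy => by
      rw [zero_mul, zero_add]
      exact neg_le_neg (hmin hy)) x₀ hx₀).2 (by simp [ν, ν'])
  -- Along `ν'` the derivative of `⟨ν, ν'⟩` is `τ D²h'(ν, ν) + D²h(ν', ν') ≥ θ a²`; it equals `-μ
  -- ⟨ν, ν'⟩`, at most `C ⟨ν, ν'⟩`.
  have h1 := Hμ ν'
  rw [zero_mul, zero_add] at h1
  have h2 := (fderiv_inner_gradient hh.contDiff hh'.contDiff 0 x₀ (f x₀) ν'
    (fderivWithin ℝ f Ω x₀ ν')).symm.trans h1
  rw [hA, map_smul, real_inner_smul_right, real_inner_comm, hh'.contDiff.inner_fderiv_gradient,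
    hh.contDiff.inner_fderiv_gradient] at h2
  have h3 := Hθ x₀ hx₀ ν'
  have h4 := Hθ' (f x₀) (hf.mapsTo_frontier hx₀) ν
  have h5 : 0 ≤ τ * fderiv ℝ (fderiv ℝ h') (f x₀) ν ν :=
    mul_nonneg hτ.le (le_trans (by positivity) h4)
  have h6 := (Ha (f x₀) (hf.mapsTo_frontier hx₀)).1
  have h7 : θ * a ^ 2 ≤ θ * ‖ν'‖ ^ 2 := by
    gcongr
  rw [div_le_iff₀ hC]
  have h8 : -μ * ⟪ν, ν'⟫ ≤ C * ⟪ν, ν'⟫ := mul_le_mul_of_nonneg_right (by linarith) hχ.le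
  simp only [ν, ν'] at *
  linarith

/-- Second order condition at the boundary along a parabola inside the domain. -/
theorem parabola_second_order (hf : IsLagrangianMap n Ω Ω' f c)
    (hh : IsStrictBoundaryDefining Ω h) {κ : ℝ}
    (hκ : ∀ p ∈ frontier Ω', ∀ q ∈ Ω', fderiv ℝ h' p (q - p) ≤ -κ * ‖q - p‖ ^ 2)
    {x : E} (hx : x ∈ frontier Ω) {w p : E} (hw : ⟪gradient h x, w⟫ = 0)
    (hp : fderiv ℝ (fderiv ℝ h) x w w < 2 * ⟪gradient h x, p⟫) :
    ⟪gradient h' (f x), fderivWithin ℝ (fderivWithin ℝ f Ω) Ω x w w -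
      (2 : ℝ) • fderivWithin ℝ f Ω x p⟫ + 2 * κ * ‖fderivWithin ℝ f Ω x w‖ ^ 2 ≤ 0 := by
  have hxΩ := hf.mem_of_mem_frontier hx
  set ν' := gradient h' (f x)
  set A := fderivWithin ℝ f Ω
  set B := fderivWithin ℝ A Ω
  rw [inner_gradient_left] at hw hp
  have hev := hh.contDiff.eventually_parabola_nonpos (hh.eq_zero x hx) hw hp
  set γ : ℝ → E := fun t => x + t • w - t ^ 2 • p with hγdef
  have hγ : ∀ t : ℝ, HasDerivAt γ (w - (2 * t) • p) t := by
    intro t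
    have := (((hasDerivAt_id t).smul_const w).const_add x).fun_sub
      ((hasDerivAt_pow 2 t).smul_const p)
    simpa using this
  have hγ' : HasDerivAt (fun t : ℝ => w - (2 * t) • p) (-((2 : ℝ) • p)) 0 := by
    have := (((hasDerivAt_id (0 : ℝ)).const_mul 2).smul_const p).const_sub w
    simpa using this
  have hγ0 : γ 0 = x := by simp [hγdef]
  have hc : Tendsto γ (𝓝 0) (𝓝 x) := by
    have := (hγ 0).continuousAt.tendsto
    rwa [hγ0] at this
  have hmem : ∀ᶠ t in 𝓝 (0 : ℝ), γ t ∈ Ω := by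
    filter_upwards [hev, hc.eventually (hh.eventually_mem x hx)] with t h1 h2 using h2 h1
  have hd1 : ∀ᶠ t in 𝓝 (0 : ℝ), HasDerivAt (fun t => f (γ t)) (A (γ t) (w - (2 * t) • p)) t := by
    filter_upwards [hmem.eventually_nhds] with t ht
    exact (hf.hasFDerivWithinAt ht.self_of_nhds).comp_hasDerivAt t (hγ t) ht
  have hd2 : HasDerivAt (fun t => A (γ t) (w - (2 * t) • p)) (B x w w - (2 : ℝ) • A x p) 0 := by
    have h1 : HasFDerivWithinAt A (B x) Ω (γ 0) := by
      rw [hγ0]; exact hf.hasFDerivWithinAt₂ hxΩ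
    have := (h1.comp_hasDerivAt (0 : ℝ) (hγ 0) hmem).clm_apply hγ'
    refine this.congr_deriv ?_
    simp [hγ0, sub_eq_add_neg]
  -- The expression vanishes at `t = 0` and, as `f (γ t) ∈ Ω'`, is nonpositive by quadratic support
  -- of the target.
  have hloc : IsLocalMax (fun t => ⟪ν', f (γ t) - f x⟫ + κ * ‖f (γ t) - f x‖ ^ 2) 0 := by
    filter_upwards [hmem] with t ht
    have := hκ (f x) (hf.mapsTo_frontier hx) (f (γ t)) (hf.mapsTo ht)
    rw [← inner_gradient_left] at this
    simp only [hγ0, sub_self, inner_zero_right, norm_zero]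
    linarith
  refine hloc.second_deriv_nonpos (φ' := fun t => ⟪ν', A (γ t) (w - (2 * t) • p)⟫ +
    κ * (2 * ⟪f (γ t) - f x, A (γ t) (w - (2 * t) • p)⟫)) ?_ ?_
  · filter_upwards [hd1] with t ht
    have := ((hasDerivAt_const t ν').inner ℝ (ht.sub_const (f x))).fun_add
      (((ht.sub_const (f x)).norm_sq).const_mul κ)
    simpa using this
  · have := ((hasDerivAt_const (0 : ℝ) ν').inner ℝ hd2).fun_add
      ((((hd1.self_of_nhds.sub_const (f x)).inner ℝ hd2).const_mul 2).const_mul κ)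
    refine this.congr_deriv ?_
    simp [hγ0]
    ring

end IsLagrangianMap

end HessianBound

/-! ### Tangential bound on the boundary and global upper bound. -/

section HessianUpperBound

open Filter Topology Metric Set
open scoped RealInnerProductSpace

/-- Division by `⟨ν, ν'⟩` is needed only where obliqueness holds, but the boundary estimate requires
a globally smooth `Φ`. -/
theorem exists_contDiff_eq_one_div {χ : ℝ} (hχ : 0 < χ) :
    ∃ j : ℝ → ℝ, ContDiff ℝ ∞ j ∧ ∀ s, χ ≤ s → j s = 1 / s := by
  have hpos : ∀ s : ℝ, s ^ 2 + (1 - Real.smoothTransition (s / χ)) ≠ 0 := by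
    intro s
    have h1 := Real.smoothTransition.le_one (s / χ)
    rcases lt_or_ge s χ with h | h
    · have h2 : Real.smoothTransition (s / χ) < 1 :=
        Real.smoothTransition.lt_one_of_lt_one ((div_lt_one hχ).2 h)
      have := sq_nonneg s
      linarith
    · have : 0 < s ^ 2 := pow_pos (hχ.trans_le h) 2
      linarith
  refine ⟨fun s => s / (s ^ 2 + (1 - Real.smoothTransition (s / χ))), ?_, fun s hs => ?_⟩
  · exact contDiff_id.div ((contDiff_id.pow 2).add (contDiff_const.sub
      (Real.smoothTransition.contDiff.comp (contDiff_id.div_const χ)))) hpos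
  · have h0 : 0 < s := hχ.trans_le hs
    simp only [Real.smoothTransition.one_of_one_le ((one_le_div hχ).2 hs)]
    field_simp
    ring

theorem ContDiff.exists_abs_fderiv_le {F : Type*} [NormedAddCommGroup F] [NormedSpace ℝ F]
    {Φ : F → ℝ} (hΦ : ContDiff ℝ ∞ Φ) {S : Set F} (hS : IsCompact S) :
    ∃ K : ℝ, 0 < K ∧ ∀ z ∈ S, ∀ v, |fderiv ℝ Φ z v| ≤ K * ‖v‖ := by
  obtain ⟨K, hK, HK⟩ := hS.exists_pos_forall_ge (f := fun z => ‖fderiv ℝ Φ z‖)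
    (Continuous.norm (E := F →L[ℝ] ℝ) (hΦ.continuous_fderiv (by simp))).continuousOn
  refine ⟨K, hK, fun z hz v => ?_⟩
  refine (ContinuousLinearMap.le_opNorm (fderiv ℝ Φ z) v).trans ?_
  exact mul_le_mul_of_nonneg_right (HK z hz) (norm_nonneg v)

variable {E : Type*} [NormedAddCommGroup E] [InnerProductSpace ℝ E] [FiniteDimensional ℝ E]

namespace IsLagrangianMap

variable {n : ℕ} {Ω Ω' : Set E} {f : E → E} {c : ℝ} {h h' : E → ℝ}

set_option maxHeartbeats 400000 in
/-- Uniform bound for the tangential second derivatives at the boundary. -/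
theorem exists_tangential_bound [Nontrivial E] (n : ℕ) (hcpt : IsCompact Ω)
    (hint : (interior Ω).Nonempty) (hcpt' : IsCompact Ω')
    (hh : IsStrictBoundaryDefining Ω h) (hh' : IsStrictBoundaryDefining Ω' h') :
    ∃ M : ℝ, 0 < M ∧ ∀ (f : E → E) (c : ℝ), IsLagrangianMap n Ω Ω' f c → ∀ x ∈ frontier Ω,
      ∀ w, ⟪gradient h x, w⟫ = 0 → ⟪fderivWithin ℝ f Ω x w, w⟫ ≤ M * ‖w‖ ^ 2 := by
  obtain ⟨C₂, hC₂, H₂⟩ := exists_normal_bound n hcpt hint hcpt' hh hh'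
  obtain ⟨χ₀, hχ₀, Hχ⟩ := exists_oblique n hcpt hint hcpt' hh hh'
  obtain ⟨a, b, ha, hb, Hab⟩ := exists_gradient_norm_bounds hcpt hh
  obtain ⟨a', b', ha', hb', Hab'⟩ := exists_gradient_norm_bounds hcpt' hh'
  obtain ⟨j, hj, Hj⟩ := exists_contDiff_eq_one_div hχ₀
  obtain ⟨κ, hκ, Hκ⟩ := hh'.support
  obtain ⟨H, hH, HH⟩ := hh.contDiff.exists_abs_fderiv_fderiv_le hcpt.isCompact_frontier
  set C₃ := b' ^ 2 / χ₀ ^ 2 + C₂ / χ₀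
  -- Write `q = ⟨ν, w⟩`, `r = ⟨ν', w⟩`, `χ = ⟨ν, ν'⟩`. For `|w| = 1` the tangential part `w - (q/χ)
  -- ν'` has squared norm `1 - 2qr/χ + q²|ν'|²/χ²`; `Φ` cancels the cross term and dominates the
  -- terms in `q²`.
  set Φ : E × E × E → ℝ := fun z =>
    2 * (⟪gradient h z.2.1, z.1⟫ * ⟪gradient h' z.2.2, z.1⟫ *
      j ⟪gradient h z.2.1, gradient h' z.2.2⟫) - C₃ * ⟪gradient h z.2.1, z.1⟫ ^ 2 with hΦdef
  have hΦ : ContDiff ℝ ∞ Φ := by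
    have g1 : ContDiff ℝ ∞ (fun z : E × E × E => ⟪gradient h z.2.1, z.1⟫) :=
      (hh.contDiff.gradient_of_infty.comp (contDiff_fst.comp contDiff_snd)).inner ℝ contDiff_fst
    have g2 : ContDiff ℝ ∞ (fun z : E × E × E => ⟪gradient h' z.2.2, z.1⟫) :=
      (hh'.contDiff.gradient_of_infty.comp (contDiff_snd.comp contDiff_snd)).inner ℝ contDiff_fst
    have g3 := hj.comp (contDiff_inner_gradient hh.contDiff hh'.contDiff)
    exact (contDiff_const.mul ((g1.mul g2).mul g3)).sub (contDiff_const.mul (g1.pow 2))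
  obtain ⟨C₄, hC₄, H₄⟩ := exists_boundary_estimate n hcpt hint hcpt' hh hΦ
  obtain ⟨K, hK, HK⟩ := hΦ.exists_abs_fderiv_le ((isCompact_closedBall (0 : E) 1).prod
    (hcpt.prod hcpt'))
  set C₅ := C₄ * (b * b') + K * (b' + C₂ * b)
  refine ⟨max 1 ((C₂ * (H + 1) + C₅) / (2 * κ)), by positivity, fun f c hf => ?_⟩
  set A := fderivWithin ℝ f Ω with hA
  set S : Set (E × E) := (frontier Ω ×ˢ closedBall (0 : E) 1) ∩
    {z | ⟪gradient h z.1, z.2⟫ = 0} with hS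
  have hScpt : IsCompact S := by
    refine (hcpt.isCompact_frontier.prod (isCompact_closedBall 0 1)).inter_right ?_
    exact isClosed_eq ((hh.contDiff.gradient_of_infty.continuous.comp continuous_fst).inner
      continuous_snd) continuous_const
  have hAcont : ContinuousOn (fun z : E × E => ⟪A z.1 z.2, z.2⟫) S := by
    have h1 : ContinuousOn (fun z : E × E => A z.1) S :=
      hf.contDiffOn_fderivWithin.continuousOn.comp continuousOn_fst
        fun z hz => hf.mem_of_mem_frontier hz.1.1
    exact (h1.clm_apply continuousOn_snd).inner continuousOn_snd
  intro x hx w hw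
  -- The maximizing direction `w₀` is kept fixed afterwards; it is tangential at `x₀`, but not at
  -- other boundary points.
  obtain ⟨⟨x₀, w₀⟩, hz₀, hmax⟩ := hScpt.exists_isMaxOn
    ⟨(x, 0), ⟨⟨hx, by simp⟩, by simp⟩⟩ hAcont
  obtain ⟨⟨hx₀, hw₀⟩, hν₀⟩ := hz₀
  simp only at hx₀ hw₀
  replace hν₀ : ⟪gradient h x₀, w₀⟫ = 0 := hν₀
  set M := ⟪A x₀ w₀, w₀⟫ with hM
  have htan : ∀ y ∈ frontier Ω, ∀ v, ⟪gradient h y, v⟫ = 0 → ⟪A y v, v⟫ ≤ M * ‖v‖ ^ 2 := by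
    intro y hy v hv
    rcases eq_or_ne v 0 with rfl | hv0
    · simp
    have hv0' : 0 < ‖v‖ := norm_pos_iff.2 hv0
    have h1 : (y, ‖v‖⁻¹ • v) ∈ S := by
      refine ⟨⟨hy, ?_⟩, ?_⟩
      · simp [norm_smul, hv0'.ne']
      · change ⟪gradient h y, ‖v‖⁻¹ • v⟫ = 0
        rw [real_inner_smul_right, hv, mul_zero]
    have h2 : ⟪A y (‖v‖⁻¹ • v), ‖v‖⁻¹ • v⟫ ≤ M := hmax h1
    rw [map_smul, real_inner_smul_left, real_inner_smul_right] at h2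
    have e : ⟪A y v, v⟫ = (‖v‖⁻¹ * (‖v‖⁻¹ * ⟪A y v, v⟫)) * ‖v‖ ^ 2 := by
      field_simp
    rw [e]
    exact mul_le_mul_of_nonneg_right h2 (by positivity)
  refine (htan x hx w hw).trans (mul_le_mul_of_nonneg_right ?_ (by positivity))
  rcases le_or_gt M 1 with hM1 | hM1
  · exact hM1.trans (le_max_left _ _)
  refine le_trans ?_ (le_max_right _ _)
  have hM0 : 0 < M := by linarith
  have hw₀1 : ‖w₀‖ ≤ 1 := by simpa using hw₀
  have hw₀n : ‖w₀‖ = 1 := by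
    refine le_antisymm hw₀1 ?_
    by_contra! hlt
    have h1 := htan x₀ hx₀ w₀ hν₀
    have h2 : ‖w₀‖ ^ 2 < 1 := by nlinarith [norm_nonneg w₀]
    nlinarith
  have hcomp : ∀ y ∈ frontier Ω, 1 / M * ⟪A y w₀, w₀⟫ + Φ (w₀, y, f y) ≤ 1 := by
    intro y hy
    obtain ⟨τ, hτ, hτ2, hAν, hχ⟩ := H₂ f c hf y hy
    have hχ' := Hχ f c hf y hy
    have hb1 := (Hab' (f y) (hf.mapsTo_frontier hy)).2
    obtain ⟨e1, e2⟩ := hf.inner_fderivWithin_self_eq (hf.mem_of_mem_frontier hy) hAν hχ w₀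
    have e3 := htan y hy _ e1
    simp only [hΦdef]
    rw [Hj _ hχ', hA, e2]
    rw [norm_sub_sq_real, norm_smul, real_inner_smul_right, mul_pow, hw₀n,
      Real.norm_eq_abs, sq_abs] at e3
    set χ := ⟪gradient h y, gradient h' (f y)⟫
    set q := ⟪gradient h y, w₀⟫
    rw [real_inner_comm (gradient h' (f y)) w₀] at e3
    set r := ⟪gradient h' (f y), w₀⟫
    set N := ‖gradient h' (f y)‖
    have i1 : (q / χ) ^ 2 * N ^ 2 ≤ q ^ 2 * (b' ^ 2 / χ₀ ^ 2) := by
      rw [div_pow, div_mul_eq_mul_div, mul_div_assoc]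
      gcongr
    have i2 : q ^ 2 * (τ / χ) ≤ q ^ 2 * (C₂ / χ₀) := by
      gcongr
    have i3 : 1 / M * (q ^ 2 * (τ / χ)) ≤ q ^ 2 * (C₂ / χ₀) := by
      have : 1 / M ≤ 1 := by rw [div_le_one hM0]; exact hM1.le
      have h0 : 0 ≤ q ^ 2 * (τ / χ) := by positivity
      nlinarith
    have i4 : 1 / M * ⟪fderivWithin ℝ f Ω y (w₀ - (q / χ) • gradient h' (f y)),
        w₀ - (q / χ) • gradient h' (f y)⟫ ≤ 1 ^ 2 - 2 * (q / χ * r) + (q / χ) ^ 2 * N ^ 2 := by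
      rw [one_div, inv_mul_le_iff₀ hM0]
      exact e3
    have i5 : q * r * (1 / χ) = q / χ * r := by ring
    rw [mul_add, i5]
    simp only [C₃]
    nlinarith
  have hval : 1 / M * ⟪A x₀ w₀, w₀⟫ + Φ (w₀, x₀, f x₀) = 1 := by
    simp only [hΦdef, hν₀, ← hM]
    field_simp
    ring
  obtain ⟨μ, hμ, Hμ⟩ := (H₄ f c hf (1 / M) 1 w₀ (by positivity) hw₀1 hcomp x₀ hx₀).2 hval
  obtain ⟨τ, hτ, hτ2, hAν, hχ⟩ := H₂ f c hf x₀ hx₀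
  have hx₀Ω := hf.mem_of_mem_frontier hx₀
  have hfx₀ := hf.mapsTo_frontier hx₀
  set ν := gradient h x₀
  set ν' := gradient h' (f x₀)
  have hνn : 0 < ‖ν‖ := ha.trans_le (Hab x₀ hx₀).1
  have k1 := Hμ ν'
  have k2 : |fderiv ℝ Φ (w₀, x₀, f x₀) (0, ν', A x₀ ν')| ≤ K * (b' + C₂ * b) := by
    refine (HK (w₀, x₀, f x₀) ⟨hw₀, hx₀Ω, hf.mapsTo hx₀Ω⟩ _).trans ?_
    refine mul_le_mul_of_nonneg_left ?_ hK.le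
    rw [Prod.norm_def, Prod.norm_def]
    simp only [norm_zero]
    have j1 : ‖ν'‖ ≤ b' := (Hab' (f x₀) hfx₀).2
    have j2 : ‖A x₀ ν'‖ ≤ C₂ * b := by
      rw [hA, hAν, norm_smul, Real.norm_of_nonneg hτ.le]
      exact mul_le_mul hτ2 (Hab x₀ hx₀).2 (norm_nonneg _) hC₂.le
    have j3 : 0 ≤ C₂ * b := by positivity
    refine max_le (by positivity) (max_le ?_ ?_) <;> linarith
  have k3 : ⟪ν, ν'⟫ ≤ b * b' :=
    (real_inner_le_norm _ _).trans (mul_le_mul (Hab x₀ hx₀).2 (Hab' (f x₀) hfx₀).2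
      (norm_nonneg _) hb.le)
  have k4 : -(C₄ * (b * b')) ≤ μ * ⟪ν, ν'⟫ := by
    have q1 : -C₄ * ⟪ν, ν'⟫ ≤ μ * ⟪ν, ν'⟫ := mul_le_mul_of_nonneg_right hμ hχ.le
    have q2 : C₄ * ⟪ν, ν'⟫ ≤ C₄ * (b * b') := mul_le_mul_of_nonneg_left k3 hC₄.le
    linarith
  have k5 : -C₅ ≤ 1 / M * ⟪fderivWithin ℝ A Ω x₀ ν' w₀, w₀⟫ := by
    have := (abs_le.1 k2).2
    simp only [C₅]
    linarith
  -- Dividing by `M` beforehand makes this lower bound linear in `M`, against the quadratic term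
  -- supplied by the parabola.
  have k6 : -(C₅ * M) ≤ ⟪fderivWithin ℝ A Ω x₀ ν' w₀, w₀⟫ := by
    rw [one_div, ← div_eq_inv_mul, le_div_iff₀ hM0] at k5
    linarith
  -- Normalized so that `2 ⟨ν, p⟩ = H + 1 > D²h(w₀, w₀)`, which keeps the parabola inside `Ω`.
  set p := ((H + 1) / (2 * ‖ν‖ ^ 2)) • ν
  have hp : 2 * ⟪ν, p⟫ = H + 1 := by
    simp only [p]
    rw [real_inner_smul_right, real_inner_self_eq_norm_sq]
    field_simp
  have k7 := hf.parabola_second_order hh Hκ hx₀ hν₀ (p := p) (by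
    change _ < 2 * ⟪ν, p⟫
    rw [hp]
    have := (abs_le.1 (HH x₀ hx₀ w₀)).2
    rw [hw₀n] at this
    linarith)
  -- Total symmetry turns the `ν'` component of `D²f(w₀, w₀)` into the derivative of `⟨Df w₀, w₀⟩`
  -- along `ν'`, the quantity bounded in `k6`.
  rw [inner_sub_right, real_inner_smul_right, real_inner_comm (A x₀ p) ν', hA,
    hf.inner_fderivWithin_comm hx₀Ω p, hAν, real_inner_smul_left,
    real_inner_comm _ (gradient h' (f x₀)), hf.second_inner_symm hx₀Ω, hf.second_symm hx₀Ω] at k7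
  have k8 : M ≤ ‖A x₀ w₀‖ := by
    have := real_inner_le_norm (A x₀ w₀) w₀
    rwa [hw₀n, mul_one] at this
  have k9 : M ^ 2 ≤ ‖A x₀ w₀‖ ^ 2 := by gcongr
  have k10 : 2 * κ * M ^ 2 ≤ C₂ * (H + 1) + C₅ * M := by
    have q1 : 2 * κ * M ^ 2 ≤ 2 * κ * ‖A x₀ w₀‖ ^ 2 := by gcongr
    have q2 : 2 * (τ * ⟪ν, p⟫) = τ * (H + 1) := by rw [← hp]; ring
    have q3 : τ * (H + 1) ≤ C₂ * (H + 1) := by gcongr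
    linarith
  rw [le_div_iff₀ (by positivity)]
  have k11 : C₂ * (H + 1) ≤ C₂ * (H + 1) * M := le_mul_of_one_le_right (by positivity) hM1.le
  have k12 : M * (M * (2 * κ)) ≤ M * (C₂ * (H + 1) + C₅) := by
    have q1 : M * (M * (2 * κ)) = 2 * κ * M ^ 2 := by ring
    have q2 : M * (C₂ * (H + 1) + C₅) = C₂ * (H + 1) * M + C₅ * M := by ring
    rw [q1, q2]
    exact k10.trans (add_le_add_left k11 _)
  exact le_of_mul_le_mul_left k12 hM0

/-- Uniform upper bound for the derivative of Lagrangian maps between two given domains. -/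
theorem exists_upper_bound [Nontrivial E] (n : ℕ) (hcpt : IsCompact Ω)
    (hint : (interior Ω).Nonempty) (hcpt' : IsCompact Ω')
    (hh : IsStrictBoundaryDefining Ω h) (hh' : IsStrictBoundaryDefining Ω' h') :
    ∃ C : ℝ, 0 < C ∧ ∀ (f : E → E) (c : ℝ), IsLagrangianMap n Ω Ω' f c → ∀ x ∈ Ω,
      ∀ w, ‖w‖ = 1 → ⟪fderivWithin ℝ f Ω x w, w⟫ ≤ C := by
  obtain ⟨C₂, hC₂, H₂⟩ := exists_normal_bound n hcpt hint hcpt' hh hh'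
  obtain ⟨χ₀, hχ₀, Hχ⟩ := exists_oblique n hcpt hint hcpt' hh hh'
  obtain ⟨a, b, ha, hb, Hab⟩ := exists_gradient_norm_bounds hcpt hh
  obtain ⟨a', b', ha', hb', Hab'⟩ := exists_gradient_norm_bounds hcpt' hh'
  obtain ⟨M, hM, HM⟩ := exists_tangential_bound n hcpt hint hcpt' hh hh'
  obtain ⟨C₄, hC₄, H₄⟩ := exists_boundary_estimate n hcpt hint hcpt' hh
    (Φ := fun _ => 0) contDiff_const
  set m := M * (1 + b / χ₀ * b') ^ 2 + b ^ 2 * (C₂ / χ₀)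
  refine ⟨m + C₄, by positivity, fun f c hf x hx w hw => ?_⟩
  have hbd : ∀ y ∈ frontier Ω, ⟪fderivWithin ℝ f Ω y w, w⟫ ≤ m := by
    intro y hy
    obtain ⟨τ, hτ, hτ2, hAν, hχ⟩ := H₂ f c hf y hy
    have hχ' := Hχ f c hf y hy
    obtain ⟨e1, e2⟩ := hf.inner_fderivWithin_self_eq (hf.mem_of_mem_frontier hy) hAν hχ w
    have e3 := HM f c hf y hy _ e1
    have hq : |⟪gradient h y, w⟫| ≤ b := by
      refine (abs_real_inner_le_norm _ _).trans ?_
      rw [hw, mul_one]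
      exact (Hab y hy).2
    have hz : ‖w - (⟪gradient h y, w⟫ / ⟪gradient h y, gradient h' (f y)⟫) •
        gradient h' (f y)‖ ≤ 1 + b / χ₀ * b' := by
      refine (norm_sub_le _ _).trans ?_
      rw [hw, norm_smul, norm_div, Real.norm_eq_abs, Real.norm_of_nonneg hχ.le]
      have := (Hab' (f y) (hf.mapsTo_frontier hy)).2
      gcongr
    have hq2 : ⟪gradient h y, w⟫ ^ 2 ≤ b ^ 2 := by
      rw [← sq_abs]
      gcongr
    rw [e2]
    refine add_le_add (e3.trans ?_) ?_
    · gcongr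
    · gcongr
  by_cases hxi : x ∈ interior Ω
  -- The barrier needs some boundary point; without one, the compact `Ω` would be clopen, hence the
  -- whole noncompact space.
  · obtain ⟨x₀, hx₀⟩ : (frontier Ω).Nonempty := by
      rw [nonempty_iff_ne_empty]
      intro h0
      have hclopen := isClopen_iff_frontier_eq_empty.2 h0
      rcases isClopen_iff.1 hclopen with h1 | h1
      · rw [h1] at hx; exact hx
      · exact noncompact_univ E (h1 ▸ hcpt)
    have := (H₄ f c hf 1 m w zero_le_one hw.le (fun y hy => by simpa using hbd y hy)
      x₀ hx₀).1 x hx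
    simpa using this
  · have := hbd x ⟨subset_closure hx, hxi⟩
    linarith

end IsLagrangianMap

end HessianUpperBound

/-! ### From potentials to Lagrangian maps by inverting the gradient. -/

section Potential

open Filter Topology Metric Set
open scoped RealInnerProductSpace

/-- The second derivative of a convex function is nonnegative at interior points. -/
theorem ConvexOn.second_fderivWithin_nonneg_of_mem_interior {E : Type*} [NormedAddCommGroup E]
    [InnerProductSpace ℝ E] {Ω : Set E} {u : E → ℝ} (hconv : ConvexOn ℝ Ω u)
    (hu : ∀ y ∈ Ω, HasFDerivWithinAt u (fderivWithin ℝ u Ω y) Ω y)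
    (hu' : ∀ y ∈ Ω, HasFDerivWithinAt (fderivWithin ℝ u Ω)
      (fderivWithin ℝ (fderivWithin ℝ u Ω) Ω y) Ω y) {x : E} (hx : x ∈ interior Ω) (v : E) :
    0 ≤ fderivWithin ℝ (fderivWithin ℝ u Ω) Ω x v v := by
  have aux : ∀ v : E, (∀ᶠ t : ℝ in 𝓝 0, HasDerivAt (fun t : ℝ => u (x + t • v))
      (fderivWithin ℝ u Ω (x + t • v) v) t) ∧
      HasDerivAt (fun t : ℝ => fderivWithin ℝ u Ω (x + t • v) v)
        (fderivWithin ℝ (fderivWithin ℝ u Ω) Ω x v v) 0 ∧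
      ∀ᶠ t : ℝ in 𝓝 0, x + t • v ∈ Ω := by
    intro v
    have hl : HasDerivAt (fun t : ℝ => x + t • v) v 0 := by
      simpa using ((hasDerivAt_id (0 : ℝ)).smul_const v).const_add x
    have hc : Tendsto (fun t : ℝ => x + t • v) (𝓝 0) (𝓝 x) := by
      simpa using hl.continuousAt.tendsto
    have hm : ∀ᶠ t : ℝ in 𝓝 0, x + t • v ∈ interior Ω :=
      hc.eventually (isOpen_interior.mem_nhds hx)
    have d2 := (eventually_hasDerivAt_line
      (φ' := fderivWithin ℝ (fderivWithin ℝ u Ω) Ω) hu' hx v).self_of_nhds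
    refine ⟨eventually_hasDerivAt_line hu hx v, ?_, hm.mono fun t ht => interior_subset ht⟩
    refine (HasDerivAt.clm_apply d2 (hasDerivAt_const (0 : ℝ) v)).congr_deriv ?_
    simp
  obtain ⟨a1, a2, a3⟩ := aux v
  obtain ⟨b1, b2, b3⟩ := aux (-v)
  -- Midpoint convexity says that the symmetric sum is minimal at `t = 0`.
  have hloc : IsLocalMax (fun t : ℝ => -(u (x + t • v) + u (x + t • (-v)))) 0 := by
    filter_upwards [a3, b3] with t ha hb
    have := hconv.2 ha hb (by norm_num : (0 : ℝ) ≤ 1 / 2) (by norm_num : (0 : ℝ) ≤ 1 / 2)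
      (by norm_num)
    have e : (1 / 2 : ℝ) • (x + t • v) + (1 / 2 : ℝ) • (x + t • (-v)) = x := by
      module
    rw [e, smul_eq_mul, smul_eq_mul] at this
    simp only [zero_smul, add_zero]
    linarith
  have := hloc.second_deriv_nonpos (φ' := fun t : ℝ => -(fderivWithin ℝ u Ω (x + t • v) v +
    fderivWithin ℝ u Ω (x + t • (-v)) (-v))) (by
      filter_upwards [a1, b1] with t h1 h2
      exact (h1.fun_add h2).fun_neg) (a2.fun_add b2).fun_neg
  simp only [map_neg, neg_apply, neg_neg] at this
  linarith

namespace IsMinimalLagrangianPotential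

variable {n : ℕ} {Ω Ω' : Set (EuclideanSpace ℝ (Fin n))} {u : EuclideanSpace ℝ (Fin n) → ℝ}
  {c : ℝ} {x : EuclideanSpace ℝ (Fin n)}

theorem uniqueDiffOn (hΩ : IsUniformlyConvexDomain Ω) : UniqueDiffOn ℝ Ω :=
  uniqueDiffOn_convex hΩ.convex hΩ.nonempty_interior

theorem hasFDerivWithinAt_fderivWithin (hΩ : IsUniformlyConvexDomain Ω)
    (hu : IsMinimalLagrangianPotential Ω Ω' u c) (hx : x ∈ Ω) :
    HasFDerivWithinAt (fderivWithin ℝ u Ω) (fderivWithin ℝ (fderivWithin ℝ u Ω) Ω x) Ω x :=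
  ((hu.contDiffOn.fderivWithin (uniqueDiffOn hΩ) (m := ∞) (by simp)).differentiableOn
    (by simp) x hx).hasFDerivWithinAt

theorem hasFDerivWithinAt_gradientWithin (hu : IsMinimalLagrangianPotential Ω Ω' u c)
    (hx : x ∈ Ω) :
    HasFDerivWithinAt (gradientWithin u Ω) (fderivWithin ℝ (gradientWithin u Ω) Ω x) Ω x :=
  (hu.isDiffeomorphismOn.1.differentiableOn (by simp) x hx).hasFDerivWithinAt

theorem inner_fderivWithin_gradientWithin (hΩ : IsUniformlyConvexDomain Ω)
    (hu : IsMinimalLagrangianPotential Ω Ω' u c) (hx : x ∈ Ω)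
    (v w : EuclideanSpace ℝ (Fin n)) :
    ⟪fderivWithin ℝ (gradientWithin u Ω) Ω x v, w⟫ =
      fderivWithin ℝ (fderivWithin ℝ u Ω) Ω x v w := by
  have h1 := (hu.hasFDerivWithinAt_gradientWithin hx).inner ℝ (hasFDerivWithinAt_const w x Ω)
  have h2 := (hu.hasFDerivWithinAt_fderivWithin hΩ hx).clm_apply (hasFDerivWithinAt_const w x Ω)
  have e : (fun y => ⟪gradientWithin u Ω y, w⟫) = fun y => fderivWithin ℝ u Ω y w :=
    funext fun y => inner_gradientWithin_left
  rw [e] at h1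
  have := congrArg (fun L : EuclideanSpace ℝ (Fin n) →L[ℝ] ℝ => L v)
    ((uniqueDiffOn hΩ x hx).eq h1 h2)
  simpa using this

/-- The interior inequality passes to the boundary by continuity, the interior being dense in `Ω`.
-/
theorem second_fderivWithin_nonneg (hΩ : IsUniformlyConvexDomain Ω)
    (hu : IsMinimalLagrangianPotential Ω Ω' u c) (hx : x ∈ Ω) (v : EuclideanSpace ℝ (Fin n)) :
    0 ≤ fderivWithin ℝ (fderivWithin ℝ u Ω) Ω x v v := by
  have hcl : x ∈ closure (interior Ω) := by
    rw [hΩ.convex.closure_interior_eq_closure_of_nonempty_interior hΩ.nonempty_interior]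
    exact subset_closure hx
  have hcont : ContinuousOn (fun y => fderivWithin ℝ (fderivWithin ℝ u Ω) Ω y v v) Ω :=
    ((((hu.contDiffOn.fderivWithin (uniqueDiffOn hΩ) (m := ∞) (by simp)).fderivWithin
      (uniqueDiffOn hΩ) (m := ∞) (by simp)).continuousOn.clm_apply continuousOn_const).clm_apply
        continuousOn_const)
  have hne : (𝓝[interior Ω] x).NeBot := mem_closure_iff_nhdsWithin_neBot.1 hcl
  refine ge_of_tendsto ((hcont x hx).mono interior_subset) ?_
  filter_upwards [self_mem_nhdsWithin] with y hy
  exact hu.convexOn.second_fderivWithin_nonneg_of_mem_interior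
    (fun z hz => (hu.contDiffOn.differentiableOn (by simp) z hz).hasFDerivWithinAt)
    (fun z hz => hu.hasFDerivWithinAt_fderivWithin hΩ hz) hy v

theorem sum_hessianMatrix (v w : EuclideanSpace ℝ (Fin n)) :
    ∑ k, ∑ l, hessianMatrix Ω u x k l * v k * w l =
      fderivWithin ℝ (fderivWithin ℝ u Ω) Ω x v w := by
  have hv : ∀ v : EuclideanSpace ℝ (Fin n), v = ∑ k, v k • EuclideanSpace.single k (1 : ℝ) :=
    fun v => by
      simpa using ((EuclideanSpace.basisFun (Fin n) ℝ).sum_repr v).symm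
  conv_rhs => rw [hv v, hv w]
  simp only [map_sum, map_smul, sum_apply, smul_apply, smul_eq_mul, Finset.mul_sum]
  rw [Finset.sum_comm]
  refine Finset.sum_congr rfl fun k _ => Finset.sum_congr rfl fun l _ => ?_
  simp only [hessianMatrix, Matrix.of_apply]
  ring

theorem fderivWithin_gradientWithin_eigenvectorBasis (hΩ : IsUniformlyConvexDomain Ω)
    (hu : IsMinimalLagrangianPotential Ω Ω' u c) (hx : x ∈ Ω)
    (hM : (hessianMatrix Ω u x).IsHermitian) (k : Fin n) :
    fderivWithin ℝ (gradientWithin u Ω) Ω x (hM.eigenvectorBasis k) =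
      hM.eigenvalues k • hM.eigenvectorBasis k := by
  refine ext_inner_right ℝ fun w => ?_
  rw [hu.inner_fderivWithin_gradientWithin hΩ hx, ← sum_hessianMatrix, Finset.sum_comm]
  have h1 : ∀ l, ∑ i, hessianMatrix Ω u x i l * (hM.eigenvectorBasis k) i =
      hM.eigenvalues k * (hM.eigenvectorBasis k) l := by
    intro l
    have := congrFun (hM.mulVec_eigenvectorBasis k) l
    rw [Matrix.mulVec, dotProduct] at this
    rw [Pi.smul_apply, smul_eq_mul] at this
    rw [← this]
    refine Finset.sum_congr rfl fun i _ => ?_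
    have hs := hM.apply l i
    rw [star_trivial] at hs
    rw [hs]
  simp_rw [← Finset.sum_mul, h1]
  rw [real_inner_smul_left, PiLp.inner_apply, Finset.mul_sum]
  refine Finset.sum_congr rfl fun l _ => ?_
  simp
  ring

/-- The inverse of the gradient of a solution is a Lagrangian map from `Ω'` to `Ω`. -/
theorem exists_isLagrangianMap (hΩ : IsUniformlyConvexDomain Ω)
    (hΩ' : IsUniformlyConvexDomain Ω') (hu : IsMinimalLagrangianPotential Ω Ω' u c) :
    ∃ (g : EuclideanSpace ℝ (Fin n) → EuclideanSpace ℝ (Fin n)) (c' : ℝ),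
      IsLagrangianMap n Ω' Ω g c' ∧ ∀ x ∈ Ω, ∃ y ∈ Ω',
        ∃ (e : OrthonormalBasis (Fin n) ℝ (EuclideanSpace ℝ (Fin n))) (l : Fin n → ℝ),
          (∀ k, 0 < l k) ∧ (∀ k, fderivWithin ℝ (gradientWithin u Ω) Ω x (e k) = l k • e k) ∧
            ∀ k, fderivWithin ℝ g Ω' y (e k) = (l k)⁻¹ • e k := by
  obtain ⟨hf, hmaps, g, hg, hgmaps, hinv⟩ := hu.isDiffeomorphismOn
  set f := gradientWithin u Ω with hfdef
  have hgd : ∀ y ∈ Ω', HasFDerivWithinAt g (fderivWithin ℝ g Ω' y) Ω' y := fun y hy =>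
    (hg.differentiableOn (by simp) y hy).hasFDerivWithinAt
  have hcomp : ∀ x ∈ Ω, ∀ v, fderivWithin ℝ g Ω' (f x) (fderivWithin ℝ f Ω x v) = v := by
    intro x hx v
    have h1 := (hgd (f x) (hmaps hx)).comp x (hu.hasFDerivWithinAt_gradientWithin hx) hmaps
    have h2 : HasFDerivWithinAt (g ∘ f) (ContinuousLinearMap.id ℝ _) Ω x :=
      (hasFDerivWithinAt_id x Ω).congr (fun y hy => hinv.1 hy) (hinv.1 hx)
    have := congrArg (fun L : EuclideanSpace ℝ (Fin n) →L[ℝ] EuclideanSpace ℝ (Fin n) => L v)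
      ((uniqueDiffOn hΩ x hx).eq h1 h2)
    simpa using this
  have heig : ∀ x ∈ Ω, ∃ (e : OrthonormalBasis (Fin n) ℝ (EuclideanSpace ℝ (Fin n)))
      (l : Fin n → ℝ), (∀ k, 0 < l k) ∧ (∀ k, fderivWithin ℝ f Ω x (e k) = l k • e k) ∧
        (∀ k, fderivWithin ℝ g Ω' (f x) (e k) = (l k)⁻¹ • e k) ∧
          ∑ k, Real.arctan (l k)⁻¹ = n * (Real.pi / 2) - c := by
    intro x hx
    have hM := hessianMatrix_isHermitian hΩ hu.contDiffOn hx
    have he := hu.fderivWithin_gradientWithin_eigenvectorBasis hΩ hx hM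
    -- Convexity gives only nonnegative eigenvalues; the diffeomorphism makes them nonzero, as `Dg ∘
    -- Df = id`.
    have hne : ∀ k, hM.eigenvalues k ≠ 0 := fun k h0 => by
      have h1 := hcomp x hx (hM.eigenvectorBasis k)
      rw [he, h0, zero_smul, map_zero] at h1
      have := hM.eigenvectorBasis.norm_eq_one k
      rw [← h1, norm_zero] at this
      exact zero_ne_one this
    have hpos : ∀ k, 0 < hM.eigenvalues k := fun k => by
      refine lt_of_le_of_ne ?_ (hne k).symm
      have h1 := hu.second_fderivWithin_nonneg hΩ hx (hM.eigenvectorBasis k)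
      rw [← hu.inner_fderivWithin_gradientWithin hΩ hx, he, real_inner_smul_left,
        real_inner_self_eq_norm_sq, hM.eigenvectorBasis.norm_eq_one] at h1
      simpa using h1
    refine ⟨hM.eigenvectorBasis, hM.eigenvalues, hpos, he, fun k => ?_, ?_⟩
    · have h1 := hcomp x hx (hM.eigenvectorBasis k)
      rw [he, map_smul] at h1
      rw [eq_inv_smul_iff₀ (hne k), h1]
    · simp_rw [fun k => Real.arctan_inv_of_pos (hpos k)]
      rw [Finset.sum_sub_distrib, ← lagrangianAngle_eq_sum_eigenvalues hM, hu.angle_eq x hx]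
      simp
  refine ⟨g, n * (Real.pi / 2) - c, ⟨hΩ'.isCompact, hΩ'.convex, hΩ'.nonempty_interior,
    hΩ.isCompact, hg, hgmaps, ?_, ?_⟩, ?_⟩
  · intro y hy
    have hyΩ' := hΩ'.isCompact.isClosed.frontier_subset hy
    -- If `g y` were interior, `f` would be open at `g y` because its derivative there is onto, and
    -- `y = f (g y)` would be interior to `Ω'`.
    refine ⟨subset_closure (hgmaps hyΩ'), fun hint => hy.2 ?_⟩
    have hnhds : Ω ∈ 𝓝 (g y) := mem_interior_iff_mem_nhds.1 hint
    have hyΩ := hgmaps hyΩ'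
    have hcd : ContDiffAt ℝ ∞ f (g y) := (hf _ hyΩ).contDiffAt hnhds
    have hd : fderiv ℝ f (g y) = fderivWithin ℝ f Ω (g y) :=
      (fderivWithin_of_mem_nhds hnhds).symm
    have hstrict := hcd.hasStrictFDerivAt (by simp)
    have hinj : Function.Injective (fderiv ℝ f (g y)) := fun v w hvw => by
      rw [hd] at hvw
      rw [← hcomp _ hyΩ v, ← hcomp _ hyΩ w, hvw]
    have hsurj : ((fderiv ℝ f (g y) : EuclideanSpace ℝ (Fin n) →L[ℝ] EuclideanSpace ℝ (Fin n)) :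
        EuclideanSpace ℝ (Fin n) →ₗ[ℝ] EuclideanSpace ℝ (Fin n)).range = ⊤ :=
      LinearMap.range_eq_top.2 (LinearMap.injective_iff_surjective.1 hinj)
    have hmap := hstrict.map_nhds_eq_of_surj hsurj
    rw [hinv.2 hyΩ'] at hmap
    rw [mem_interior_iff_mem_nhds, ← hmap]
    exact mem_map.2 (mem_of_superset hnhds hmaps)
  · intro y hy
    obtain ⟨e, l, hl, -, h1, h2⟩ := heig (g y) (hgmaps hy)
    rw [hinv.2 hy] at h1
    exact ⟨e, fun k => (l k)⁻¹, fun k => inv_pos.2 (hl k), h1, h2⟩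
  · intro x hx
    obtain ⟨e, l, hl, h0, h1, -⟩ := heig x hx
    exact ⟨f x, hmaps hx, e, l, hl, h0, h1⟩

end IsMinimalLagrangianPotential

end Potential

/-! ### The lower bound for the Hessian. -/

theorem mainTheorem4 (n : ℕ) (Ω Ω' : Set (EuclideanSpace ℝ (Fin n)))
    (hΩ : IsUniformlyConvexDomain Ω) (hΩ' : IsUniformlyConvexDomain Ω') :
    ∃ C : ℝ, 0 < C ∧
      ∀ (u : EuclideanSpace ℝ (Fin n) → ℝ) (c : ℝ), IsMinimalLagrangianPotential Ω Ω' u c →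
        ∀ x ∈ Ω, ∀ w : EuclideanSpace ℝ (Fin n),
          1 / C * ‖w‖ ^ 2 ≤ ∑ k, ∑ l, hessianMatrix Ω u x k l * w k * w l := by
  rcases Nat.eq_zero_or_pos n with rfl | hn
  -- In dimension `0` there are no solutions, since the interval for `c` is empty.
  · refine ⟨1, one_pos, fun u c hu => ?_⟩
    have := hu.mem_Ioo
    simp at this
  have : NeZero n := ⟨hn.ne'⟩
  obtain ⟨h, hh⟩ := hΩ.exists_isStrictBoundaryDefining
  obtain ⟨h', hh'⟩ := hΩ'.exists_isStrictBoundaryDefining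
  -- The domains are exchanged, since the bound is applied to the inverse of the gradient.
  obtain ⟨C, hC, H⟩ := IsLagrangianMap.exists_upper_bound n hΩ'.isCompact hΩ'.nonempty_interior
    hΩ.isCompact hh' hh
  refine ⟨C, hC, fun u c hu x hx w => ?_⟩
  obtain ⟨g, c', hg, hx'⟩ := hu.exists_isLagrangianMap hΩ hΩ'
  obtain ⟨y, hy, e, l, hl, he, he'⟩ := hx' x hx
  rw [IsMinimalLagrangianPotential.sum_hessianMatrix,
    ← hu.inner_fderivWithin_gradientWithin hΩ hx, e.inner_map_eq_sum he, ← e.sum_inner_sq,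
    Finset.mul_sum]
  refine Finset.sum_le_sum fun k _ => ?_
  rw [sq]
  refine mul_le_mul_of_nonneg_right ?_ (mul_self_nonneg _)
  have h1 := H g c' hg y hy (e k) (e.norm_eq_one k)
  rw [he', real_inner_smul_left, real_inner_self_eq_norm_sq, e.norm_eq_one, one_pow, mul_one]
    at h1
  rw [one_div]
  exact inv_le_of_inv_le₀ (hl k) h1
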